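/- Let $d\ge 1$ and $q\in\mathbb C\setminus\{0\}$. For $n\ge 0$ let $B_n$ be the braid group with generators $\sigma_1,\dots,\sigma_{n-1}$, and let $\mathcal F_{d,n}\cong(\mathbb Z/d\mathbb Z)^n\rtimes B_n$ be the modular framed braid group, generated by the $\sigma_i$, subject to the braid relations, together with $t_1,\dots,t_n$, subject to $t_it_j=t_jt_i$, $t_j\sigma_i=\sigma_it_{s_i(j)}$ with $s_i=(i,i+1)$, and $t_j^d=1$. Put $e_i=\frac1d\sum_{s=1}^{d}t_i^st_{i+1}^{-s}\in\mathbb C\mathcal F_{d,n}$. The Yokonuma--Hecke algebra $\mathrm Y_{d,n}(q)$ is the quotient of $\mathbb C\mathcal F_{d,n}$ by the relations $\sigma_i^2=1+(q-q^{-1})e_i\sigma_i$ $(1\le i\le n-1)$; the image of $\sigma_i$ is denoted $g_i$, and braids are identified with their images in $\mathrm Y_{d,n}(q)$. Let $D\subseteq\mathbb Z/d\mathbb Z$ be non-empty, let $\mathrm x_k=\frac1{|D|}\sum_{m\in D}\exp(2\pi\sqrt{-1}\,mk/d)$ $(k\in\mathbb Z/d\mathbb Z)$ be the corresponding solution of the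 E-system $\sum_{s}\mathrm x_{m+s}\mathrm x_{-s}=\mathrm x_m\sum_s\mathrm x_s\mathrm x_{-s}$, $\mathrm x_0=1$, and let $E_D=\frac1d\sum_s\mathrm x_s\mathrm x_{-s}=\frac1{|D|}$. There is a unique linear map $\mathrm{tr}_{d,D}=\mathrm{tr}_{d,D}(q,z):\bigcup_n\mathrm Y_{d,n}(q)\to\mathbb C[z]$ with 1. $\mathrm{tr}_{d,D}(ab)=\mathrm{tr}_{d,D}(ba)$ for $a,b\in\mathrm Y_{d,n}(q)$, 2. $\mathrm{tr}_{d,D}(1)=1$, 3. $\mathrm{tr}_{d,D}(a g_n)=z\,\mathrm{tr}_{d,D}(a)$ for $a\in\mathrm Y_{d,n}(q)$, $n\ge 1$, 4. $\mathrm{tr}_{d,D}(a t_{n+1}^s)=\mathrm x_s\,\mathrm{tr}_{d,D}(a)$ for $a\in\mathrm Y_{d,n}(q)$, $1\le s\le d-1$, and it satisfies $\mathrm{tr}_{d,D}(e_i)=E_D$ for all $i$. For $\alpha\in B_n$ let $\alpha^*$ be the image of $\alpha$ under the automorphism of $B_n$ with $\sigma_i\mapsto\sigma_i^{-1}$. Then,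 for every $n$ and every $\alpha\in B_n$, $$\mathrm{tr}_{d,D}(q,z)(\alpha^*)=\mathrm{tr}_{d,D}\bigl(q^{-1},\,z-(q-q^{-1})E_D\bigr)(\alpha)\quad\text{in }\mathbb C[z],$$ where the right-hand side is the trace on $\mathrm Y_{d,n}(q^{-1})$ with $z-(q-q^{-1})E_D$ substituted for $z$. Equivalently, in terms of the variable $\lambda_D=\frac{z-(q-q^{-1})E_D}{z}$, i.e. writing $\mathrm{tr}_{d,D}(q,\lambda_D)$ for the trace with $z=\frac{(q-q^{-1})E_D}{1-\lambda_D}$ substituted, $$\mathrm{tr}_{d,D}(q,\lambda_D)(\alpha^*)=\mathrm{tr}_{d,D}(q^{-1},\lambda_D^{-1})(\alpha)\qquad(\lambda_D\in\mathbb C\setminus\{0,1\}).$$ -/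

import Mathlib

open Polynomial

namespace YokonumaHecke

noncomputable section

/-! Strands and generators are indexed from `0`: on `n` strands the braiding generators are indexed
by `Fin (n - 1)` and the framing generators by `Fin n`; the braiding generator of index `i` crosses
the strands `i` and `i + 1`. -/

/-! ### The classical braid group and mirror images -/

/-- Artin's braid relations, each relation `a = b` being given by the relator `a * b⁻¹`. -/
inductive BraidRel (n : ℕ) : FreeGroup (Fin (n - 1)) → Prop
  | braid (i j : Fin (n - 1)) (h : (i : ℕ) + 1 = j) :
      BraidRel n (FreeGroup.of i * FreeGroup.of j * FreeGroup.of i *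
        (FreeGroup.of j * FreeGroup.of i * FreeGroup.of j)⁻¹)
  | comm (i j : Fin (n - 1)) (h : (i : ℕ) + 1 < j) :
      BraidRel n (FreeGroup.of i * FreeGroup.of j * (FreeGroup.of j * FreeGroup.of i)⁻¹)

/-- The classical braid group `B_n`. -/
abbrev Braid (n : ℕ) : Type := PresentedGroup {r | BraidRel n r}

/-- The standard generator `σ_i` of `B_n`. -/
def Braid.sigma {n : ℕ} (i : Fin (n - 1)) : Braid n := PresentedGroup.of i

theorem Braid.sigma_braid {n : ℕ} (i j : Fin (n - 1)) (h : (i : ℕ) + 1 = j) :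
    sigma i * sigma j * sigma i = sigma j * sigma i * sigma j :=
  mul_inv_eq_one.mp
    (PresentedGroup.one_of_mem (rels := {r | BraidRel n r}) (BraidRel.braid i j h))

theorem Braid.sigma_comm {n : ℕ} (i j : Fin (n - 1)) (h : (i : ℕ) + 1 < j) :
    sigma i * sigma j = sigma j * sigma i :=
  mul_inv_eq_one.mp
    (PresentedGroup.one_of_mem (rels := {r | BraidRel n r}) (BraidRel.comm i j h))

/-- The mirror image `α ↦ α^*`: the endomorphism of `B_n` with `σ_i ↦ σ_i⁻¹`. -/
def Braid.mirror (n : ℕ) : Braid n →* Braid n :=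
  PresentedGroup.toGroup (f := fun i => (Braid.sigma i)⁻¹) (by
    rintro r (⟨i, j, h⟩ | ⟨i, j, h⟩)
    · have := congrArg (·⁻¹) (Braid.sigma_braid i j h)
      simp only [map_mul, map_inv, FreeGroup.lift_apply_of, mul_inv_eq_one]
      simpa [mul_assoc] using this
    · have := congrArg (·⁻¹) (Braid.sigma_comm i j h)
      simp only [map_mul, map_inv, FreeGroup.lift_apply_of, mul_inv_eq_one]
      simpa using this.symm)

/-! ### The modular framed braid group -/

/-- The generators of the framed braid group on `n` strands. -/
inductive FramedGen (n : ℕ) : Type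
  | sigma (i : Fin (n - 1))
  | t (j : Fin n)

/-- The strand `i` as an element of `Fin n`, for an index `i` of a braiding generator. -/
def lo {n : ℕ} (i : Fin (n - 1)) : Fin n := ⟨i, by omega⟩

/-- The strand `i + 1` as an element of `Fin n`, for an index `i` of a braiding generator. -/
def hi {n : ℕ} (i : Fin (n - 1)) : Fin n := ⟨i + 1, by omega⟩

section
open FramedGen FreeGroup

/-- The relators `a * b⁻¹` of the defining relations `a = b` of the modular framed braid group. -/
inductive FramedRel (d n : ℕ) : FreeGroup (FramedGen n) → Prop
  | braid (i j : Fin (n - 1)) (h : (i : ℕ) + 1 = j) :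
      FramedRel d n (of (sigma i) * of (sigma j) * of (sigma i) *
        (of (sigma j) * of (sigma i) * of (sigma j))⁻¹)
  | comm (i j : Fin (n - 1)) (h : (i : ℕ) + 1 < j) :
      FramedRel d n (of (sigma i) * of (sigma j) * (of (sigma j) * of (sigma i))⁻¹)
  | framing_comm (i j : Fin n) :
      FramedRel d n (of (t i) * of (t j) * (of (t j) * of (t i))⁻¹)
  | framing_braid (i : Fin (n - 1)) (j : Fin n) :
      FramedRel d n (of (t j) * of (sigma i) *
        (of (sigma i) * of (t (Equiv.swap (lo i) (hi i) j)))⁻¹)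
  | modular (j : Fin n) : FramedRel d n (of (t j) ^ d)

end

/-- The modular framed braid group `F_{d,n}`. -/
abbrev Framed (d n : ℕ) : Type := PresentedGroup {r | FramedRel d n r}

namespace Framed

/-- The braiding generator `σ_i` of `F_{d,n}`. -/
def sigma {d n : ℕ} (i : Fin (n - 1)) : Framed d n := PresentedGroup.of (FramedGen.sigma i)

/-- The framing generator `t_j` of `F_{d,n}`. -/
def t {d n : ℕ} (j : Fin n) : Framed d n := PresentedGroup.of (FramedGen.t j)

variable {d n : ℕ}

theorem rel_eq_one {r : FreeGroup (FramedGen n)} (h : FramedRel d n r) :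
    PresentedGroup.mk {r | FramedRel d n r} r = 1 :=
  PresentedGroup.one_of_mem (rels := {r | FramedRel d n r}) h

theorem sigma_braid (i j : Fin (n - 1)) (h : (i : ℕ) + 1 = j) :
    (sigma i * sigma j * sigma i : Framed d n) = sigma j * sigma i * sigma j :=
  mul_inv_eq_one.mp (rel_eq_one (FramedRel.braid i j h))

theorem sigma_comm (i j : Fin (n - 1)) (h : (i : ℕ) + 1 < j) :
    (sigma i * sigma j : Framed d n) = sigma j * sigma i :=
  mul_inv_eq_one.mp (rel_eq_one (FramedRel.comm i j h))

theorem t_comm (i j : Fin n) : (t i * t j : Framed d n) = t j * t i :=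
  mul_inv_eq_one.mp (rel_eq_one (FramedRel.framing_comm i j))

theorem t_sigma (i : Fin (n - 1)) (j : Fin n) :
    (t j * sigma i : Framed d n) = sigma i * t (Equiv.swap (lo i) (hi i) j) :=
  mul_inv_eq_one.mp (rel_eq_one (FramedRel.framing_braid i j))

theorem t_pow (j : Fin n) : (t j : Framed d n) ^ d = 1 :=
  rel_eq_one (FramedRel.modular j)

/-- The natural homomorphism `B_n → F_{d,n}`, `σ_i ↦ σ_i` (all framings zero). -/
def ofBraid (d n : ℕ) : Braid n →* Framed d n :=
  PresentedGroup.toGroup (f := fun i => sigma i) (by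
    rintro r (⟨i, j, h⟩ | ⟨i, j, h⟩)
    · simpa only [map_mul, map_inv, FreeGroup.lift_apply_of, mul_inv_eq_one] using sigma_braid i j h
    · simpa only [map_mul, map_inv, FreeGroup.lift_apply_of, mul_inv_eq_one] using sigma_comm i j h)

/-- The index of a braiding generator, seen on one more strand. -/
def up {n : ℕ} (i : Fin (n - 1)) : Fin (n + 1 - 1) := ⟨i, by omega⟩

theorem castSucc_swap (i : Fin (n - 1)) (j : Fin n) :
    (Equiv.swap (lo i) (hi i) j).castSucc =
      Equiv.swap (lo (up i)) (hi (up i)) j.castSucc := by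
  have := (Fin.castSucc_injective n).map_swap (x := lo i) (y := hi i) (z := j)
  simpa [lo, hi, up] using this

/-- The natural homomorphism `F_{d,n} → F_{d,n+1}`, adding a strand of framing zero on the right. -/
def succ (d n : ℕ) : Framed d n →* Framed d (n + 1) :=
  PresentedGroup.toGroup
    (f := fun x => match x with
      | FramedGen.sigma i => sigma (up i)
      | FramedGen.t j => t j.castSucc) (by
    rintro r (⟨i, j, h⟩ | ⟨i, j, h⟩ | ⟨i, j⟩ | ⟨i, j⟩ | ⟨j⟩)
    · simpa only [map_mul, map_inv, FreeGroup.lift_apply_of, mul_inv_eq_one] using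
        sigma_braid (up i) (up j) h
    · simpa only [map_mul, map_inv, FreeGroup.lift_apply_of, mul_inv_eq_one] using
        sigma_comm (up i) (up j) h
    · simpa only [map_mul, map_inv, FreeGroup.lift_apply_of, mul_inv_eq_one] using
        t_comm i.castSucc j.castSucc
    · simpa only [map_mul, map_inv, FreeGroup.lift_apply_of, mul_inv_eq_one, castSucc_swap] using
        t_sigma (up i) j.castSucc
    · simpa only [map_pow, FreeGroup.lift_apply_of] using t_pow j.castSucc)

theorem succ_sigma (i : Fin (n - 1)) : succ d n (sigma i) = sigma (up i) :=
  PresentedGroup.toGroup.of _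

theorem succ_t (j : Fin n) : succ d n (t j) = t j.castSucc :=
  PresentedGroup.toGroup.of _

end Framed

/-! ### The Yokonuma--Hecke algebra -/

/-- The image of an element of `F_{d,n}` in the group algebra `ℂ F_{d,n}`. -/
def grp {d n : ℕ} : Framed d n →* MonoidAlgebra ℂ (Framed d n) :=
  MonoidAlgebra.of ℂ (Framed d n)

/-- The idempotent `e_i = (1/d) ∑_{1 ≤ s ≤ d} t_i^s t_{i+1}^{-s}` of `ℂ F_{d,n}`. -/
def idem (d : ℕ) {n : ℕ} (i : Fin (n - 1)) : MonoidAlgebra ℂ (Framed d n) :=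
  (1 / (d : ℂ)) • ∑ s ∈ Finset.Icc 1 d, grp (Framed.t (lo i) ^ s * (Framed.t (hi i) ^ s)⁻¹)

/-- The quadratic relations `σ_i² = 1 + (q - q⁻¹) e_i σ_i`. -/
inductive QuadRel (d : ℕ) (q : ℂ) (n : ℕ) :
    MonoidAlgebra ℂ (Framed d n) → MonoidAlgebra ℂ (Framed d n) → Prop
  | quad (i : Fin (n - 1)) :
      QuadRel d q n (grp (Framed.sigma i) ^ 2)
        (1 + (q - q⁻¹) • (idem d i * grp (Framed.sigma i)))

/-- The Yokonuma--Hecke algebra `Y_{d,n}(q)`, the quotient of `ℂ F_{d,n}` by the quadratic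
relations. -/
abbrev Y (d : ℕ) (q : ℂ) (n : ℕ) : Type := RingQuot (QuadRel d q n)

namespace Y

/-- The canonical projection `ℂ F_{d,n} → Y_{d,n}(q)`. -/
def proj (d : ℕ) (q : ℂ) (n : ℕ) : MonoidAlgebra ℂ (Framed d n) →ₐ[ℂ] Y d q n :=
  RingQuot.mkAlgHom ℂ (QuadRel d q n)

/-- The image in `Y_{d,n}(q)` of a framed braid. -/
def ofFramed (d : ℕ) (q : ℂ) (n : ℕ) : Framed d n →* Y d q n :=
  (proj d q n : MonoidAlgebra ℂ (Framed d n) →* Y d q n).comp grp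

/-- The image in `Y_{d,n}(q)` of a classical braid, `σ_i ↦ g_i`. -/
def ofBraid (d : ℕ) (q : ℂ) (n : ℕ) : Braid n →* Y d q n :=
  (ofFramed d q n).comp (Framed.ofBraid d n)

/-- The generator `g_i` of `Y_{d,n}(q)`. -/
def g {d : ℕ} {q : ℂ} {n : ℕ} (i : Fin (n - 1)) : Y d q n := ofFramed d q n (Framed.sigma i)

/-- The generator `t_j` of `Y_{d,n}(q)`. -/
def t {d : ℕ} {q : ℂ} {n : ℕ} (j : Fin n) : Y d q n := ofFramed d q n (Framed.t j)

/-- The idempotent `e_i` of `Y_{d,n}(q)`. -/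
def e {d : ℕ} {q : ℂ} {n : ℕ} (i : Fin (n - 1)) : Y d q n := proj d q n (idem d i)

/-- The natural homomorphism `Y_{d,n}(q) → Y_{d,n+1}(q)`, `g_i ↦ g_i`, `t_j ↦ t_j`. -/
def incl (d : ℕ) (q : ℂ) (n : ℕ) : Y d q n →ₐ[ℂ] Y d q (n + 1) :=
  RingQuot.liftAlgHom ℂ
    ⟨MonoidAlgebra.lift ℂ (Y d q (n + 1)) (Framed d n)
      ((ofFramed d q (n + 1)).comp (Framed.succ d n)), by
    have key : ∀ x : Framed d n,
        MonoidAlgebra.lift ℂ (Y d q (n + 1)) (Framed d n)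
          ((ofFramed d q (n + 1)).comp (Framed.succ d n)) (grp x) =
        proj d q (n + 1) (grp (Framed.succ d n x)) := by
      intro x
      simp [grp, ofFramed]
    rintro _ _ ⟨i⟩
    have he : MonoidAlgebra.lift ℂ (Y d q (n + 1)) (Framed d n)
          ((ofFramed d q (n + 1)).comp (Framed.succ d n)) (idem d i) =
        proj d q (n + 1) (idem d (Framed.up i)) := by
      simp only [idem, map_smul, map_sum, key]
      simp only [map_mul, map_inv, map_pow, Framed.succ_t]
      rfl
    have hr : proj d q (n + 1) _ = proj d q (n + 1) _ :=
      RingQuot.mkAlgHom_rel ℂ (QuadRel.quad (d := d) (q := q) (Framed.up i))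
    simp only [map_add, map_mul, map_pow, map_smul, map_one, key, he, Framed.succ_sigma]
    simpa only [map_add, map_mul, map_pow, map_smul, map_one] using hr⟩

end Y

/-! ### The E-system -/

/-- `E^{(m)} = (1/d) ∑_s x_{m+s} x_{-s}`, with indices modulo `d`. -/
def EE {d : ℕ} [NeZero d] (x : ZMod d → ℂ) (m : ZMod d) : ℂ :=
  (1 / (d : ℂ)) * ∑ s : ZMod d, x (m + s) * x (-s)

/-- Solutions of the E-system `E^{(m)} = x_m E^{(0)}` (`m ≠ 0`), with the convention `x_0 = 1`. -/
def IsESolution {d : ℕ} [NeZero d] (x : ZMod d → ℂ) : Prop :=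
  x 0 = 1 ∧ ∀ m : ZMod d, m ≠ 0 → EE x m = x m * EE x 0

/-- The solution `X_D` of the E-system parametrized by `D ⊆ ℤ/dℤ`:
`x_k = (1/|D|) ∑_{m ∈ D} exp(2π√-1 m k / d)`. -/
def XD {d : ℕ} [NeZero d] (D : Finset (ZMod d)) (k : ZMod d) : ℂ :=
  (1 / (D.card : ℂ)) * ∑ m ∈ D, ZMod.stdAddChar (m * k)

/-- `E_D`, the value of `E = E^{(0)}` at the solution `X_D`. -/
def ED {d : ℕ} [NeZero d] (D : Finset (ZMod d)) : ℂ := EE (XD D) 0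

theorem sum_char {d : ℕ} [NeZero d] (a : ZMod d) :
    ∑ s : ZMod d, (ZMod.stdAddChar (a * s) : ℂ) = if a = 0 then (d : ℂ) else 0 := by
  have := AddChar.sum_mulShift a (ZMod.isPrimitive_stdAddChar d)
  simpa [mul_comm] using this

theorem EE_XD {d : ℕ} [NeZero d] (D : Finset (ZMod d)) (m : ZMod d) :
    EE (XD D) m = 1 / (D.card : ℂ) * XD D m := by
  have hd : (d : ℂ) ≠ 0 := Nat.cast_ne_zero.mpr (NeZero.ne d)
  have h : ∑ s : ZMod d, (∑ a ∈ D, (ZMod.stdAddChar (a * (m + s)) : ℂ)) *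
      (∑ b ∈ D, (ZMod.stdAddChar (b * -s) : ℂ)) =
      (d : ℂ) * ∑ a ∈ D, (ZMod.stdAddChar (a * m) : ℂ) := by
    simp_rw [Finset.sum_mul_sum]
    rw [Finset.sum_comm, Finset.mul_sum]
    refine Finset.sum_congr rfl fun a ha => ?_
    rw [Finset.sum_comm]
    have : ∀ b ∈ D, ∑ s : ZMod d, (ZMod.stdAddChar (a * (m + s)) : ℂ) *
        ZMod.stdAddChar (b * -s) =
        if a = b then (d : ℂ) * ZMod.stdAddChar (a * m) else 0 := by
      intro b _
      have : ∀ s : ZMod d, (ZMod.stdAddChar (a * (m + s)) : ℂ) * ZMod.stdAddChar (b * -s) =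
          ZMod.stdAddChar (a * m) * ZMod.stdAddChar ((a - b) * s) := by
        intro s
        rw [← AddChar.map_add_eq_mul, ← AddChar.map_add_eq_mul]
        congr 1
        ring
      simp_rw [this]
      rw [← Finset.mul_sum, sum_char]
      simp [sub_eq_zero, mul_comm]
    rw [Finset.sum_congr rfl this]
    simp [ha]
  have h2 : ∀ s : ZMod d, XD D (m + s) * XD D (-s) =
      (1 / (D.card : ℂ)) ^ 2 * ((∑ a ∈ D, (ZMod.stdAddChar (a * (m + s)) : ℂ)) *
      (∑ b ∈ D, (ZMod.stdAddChar (b * -s) : ℂ))) := by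
    intro s
    simp only [XD]
    ring
  simp only [EE, h2]
  rw [← Finset.mul_sum, h, XD]
  field_simp

theorem XD_zero {d : ℕ} [NeZero d] (D : Finset (ZMod d)) (hD : D.Nonempty) : XD D 0 = 1 := by
  have : (D.card : ℂ) ≠ 0 := Nat.cast_ne_zero.mpr hD.card_pos.ne'
  simp [XD, this]

theorem ED_eq {d : ℕ} [NeZero d] (D : Finset (ZMod d)) (hD : D.Nonempty) :
    ED D = 1 / (D.card : ℂ) := by
  rw [ED, EE_XD, XD_zero D hD, mul_one]

/-- The solutions of the E-system are exactly the `X_D` with `D` non-empty. -/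
theorem isESolution_iff {d : ℕ} [NeZero d] (x : ZMod d → ℂ) :
    IsESolution x ↔ ∃ D : Finset (ZMod d), D.Nonempty ∧ x = XD D := by
  classical
  have hd : (d : ℂ) ≠ 0 := Nat.cast_ne_zero.mpr (NeZero.ne d)
  constructor
  · rintro ⟨h0, h⟩
    have hall : ∀ m, EE x m = x m * EE x 0 := by
      intro m
      by_cases hm : m = 0
      · rw [hm, h0, one_mul]
      · exact h m hm
    set c := EE x 0 with hc
    let y : ZMod d → ℂ := fun a => ∑ k, x k * ZMod.stdAddChar (-(a * k))
    have hy : ∀ a, y a * y a = d * c * y a := by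
      intro a
      have h1 : ∑ m, EE x m * (ZMod.stdAddChar (-(a * m)) : ℂ) = c * y a := by
        simp only [hall, y, Finset.mul_sum]
        exact Finset.sum_congr rfl fun m _ => by ring
      have h2 : ∑ m, EE x m * (ZMod.stdAddChar (-(a * m)) : ℂ) = 1 / d * (y a * y a) := by
        have hyy : y a * y a = ∑ s : ZMod d, ∑ m : ZMod d,
            (x (m + s) * ZMod.stdAddChar (-(a * (m + s)))) *
              (x (-s) * ZMod.stdAddChar (-(a * -s))) := by
          simp only [y]
          rw [Finset.sum_mul_sum, Finset.sum_comm, ← Equiv.sum_comp (Equiv.neg (ZMod d))]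
          exact Finset.sum_congr rfl fun s _ => (Equiv.sum_comp (Equiv.addRight s) _).symm
        rw [hyy, Finset.sum_comm, Finset.mul_sum]
        refine Finset.sum_congr rfl fun m _ => ?_
        rw [EE, mul_assoc, Finset.sum_mul]
        congr 1
        refine Finset.sum_congr rfl fun s _ => ?_
        have : (ZMod.stdAddChar (-(a * m)) : ℂ) =
            ZMod.stdAddChar (-(a * (m + s))) * ZMod.stdAddChar (-(a * -s)) := by
          rw [← AddChar.map_add_eq_mul]
          congr 1
          ring
        rw [this]
        ring
      rw [h2] at h1
      field_simp at h1
      linear_combination h1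
    have hinv : ∀ k, (d : ℂ) * x k = ∑ a, y a * ZMod.stdAddChar (a * k) := by
      intro k
      simp only [y, Finset.sum_mul]
      rw [Finset.sum_comm]
      have : ∀ j : ZMod d, ∑ a : ZMod d, x j * ZMod.stdAddChar (-(a * j)) *
          (ZMod.stdAddChar (a * k) : ℂ) = if j = k then (d : ℂ) * x k else 0 := by
        intro j
        have : ∀ a : ZMod d, x j * ZMod.stdAddChar (-(a * j)) *
            (ZMod.stdAddChar (a * k) : ℂ) = x j * ZMod.stdAddChar ((k - j) * a) := by
          intro a
          rw [mul_assoc, ← AddChar.map_add_eq_mul]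
          congr 2
          ring
        simp_rw [this]
        rw [← Finset.mul_sum, sum_char]
        by_cases hjk : j = k
        · simp [hjk, mul_comm]
        · simp [hjk, sub_eq_zero, Ne.symm hjk]
      simp [this]
    let D : Finset (ZMod d) := Finset.univ.filter fun a => y a ≠ 0
    have hx : ∀ k, x k = c * ∑ a ∈ D, ZMod.stdAddChar (a * k) := by
      intro k
      apply mul_left_cancel₀ hd
      rw [hinv, Finset.mul_sum, Finset.mul_sum, Finset.sum_filter]
      refine Finset.sum_congr rfl fun a _ => ?_
      by_cases ha : y a = 0
      · simp [ha]
      · rw [if_pos ha, mul_right_cancel₀ ha (hy a)]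
        ring
    have hcard : c * D.card = 1 := by
      rw [← h0, hx 0]
      simp
    have hD0 : (D.card : ℂ) ≠ 0 := right_ne_zero_of_mul_eq_one hcard
    refine ⟨D, ?_, ?_⟩
    · rw [← Finset.card_pos]
      exact Nat.pos_of_ne_zero (by exact_mod_cast hD0)
    · funext k
      rw [hx k, XD, eq_one_div_of_mul_eq_one_left hcard]
  · rintro ⟨D, hD, rfl⟩
    refine ⟨XD_zero D hD, fun m _ => ?_⟩
    rw [EE_XD, EE_XD, XD_zero D hD]
    ring

/-! ### The specialized trace -/

/-- The rules of the Markov trace on `⋃_n Y_{d,n}(q)` with values in `ℂ[z]` and framing parameters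
`x_s`. A linear map on the union is a family of linear maps on the `Y_{d,n}(q)` that is compatible
with the natural homomorphisms `Y_{d,n}(q) → Y_{d,n+1}(q)`. -/
structure IsMarkovTrace (d : ℕ) (q : ℂ) (x : ZMod d → ℂ)
    (tr : ∀ n : ℕ, Y d q n →ₗ[ℂ] ℂ[X]) : Prop where
  compat : ∀ (n : ℕ) (a : Y d q n), tr (n + 1) (Y.incl d q n a) = tr n a
  trace : ∀ (n : ℕ) (a b : Y d q n), tr n (a * b) = tr n (b * a)
  one : ∀ n : ℕ, tr n 1 = 1
  markov : ∀ (n : ℕ) (a : Y d q (n + 1)),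
    tr (n + 2) (Y.incl d q (n + 1) a * Y.g ⟨n, by omega⟩) = X * tr (n + 1) a
  framing : ∀ (n : ℕ) (a : Y d q n) (s : ℕ), 1 ≤ s → s ≤ d - 1 →
    tr (n + 1) (Y.incl d q n a * Y.t (Fin.last n) ^ s) = C (x s) * tr n a

/-- The specialized trace `tr_{d,D}` on `⋃_n Y_{d,n}(q)`: the family of linear maps that satisfies
the rules of the Markov trace with framing parameters `X_D`. -/
def tr {d : ℕ} [NeZero d] (D : Finset (ZMod d)) (q : ℂ) : ∀ n : ℕ, Y d q n →ₗ[ℂ] ℂ[X] :=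
  Classical.epsilon (IsMarkovTrace d q (XD D))

/-- `tr_{d,D}(q, z)(α) ∈ ℂ[z]` for a classical braid `α`. -/
def brTr {d : ℕ} [NeZero d] (D : Finset (ZMod d)) (q : ℂ) {n : ℕ} (α : Braid n) : ℂ[X] :=
  tr D q n (Y.ofBraid d q n α)

/-- The change of variables `λ_D = (z - (q - q⁻¹) E_D) / z`. -/
def lamD {d : ℕ} [NeZero d] (D : Finset (ZMod d)) (q z : ℂ) : ℂ :=
  (z - (q - q⁻¹) * ED D) / z

/-- The inverse change of variables `z = (q - q⁻¹) E_D / (1 - λ_D)`. -/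
def zD {d : ℕ} [NeZero d] (D : Finset (ZMod d)) (q lam : ℂ) : ℂ :=
  (q - q⁻¹) * ED D / (1 - lam)

theorem zD_lamD {d : ℕ} [NeZero d] (D : Finset (ZMod d)) (hD : D.Nonempty) (q z : ℂ)
    (hq : q - q⁻¹ ≠ 0) (hz : z ≠ 0) : zD D q (lamD D q z) = z := by
  have hE : ED D ≠ 0 := by
    rw [ED_eq D hD]
    exact one_div_ne_zero (Nat.cast_ne_zero.mpr hD.card_pos.ne')
  have h : 1 - lamD D q z = (q - q⁻¹) * ED D / z := by
    rw [lamD]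
    field_simp
    ring
  rw [zD, h, div_div_cancel₀ (mul_ne_zero hq hE)]

/-- `tr_{d,D}(q, λ_D)(α)`: the trace in the variables `(q, λ_D)`. -/
def brTrLam {d : ℕ} [NeZero d] (D : Finset (ZMod d)) (q lam : ℂ) {n : ℕ} (α : Braid n) : ℂ :=
  (brTr D q α).eval (zD D q lam)

end

end YokonumaHecke

namespace YokonumaHecke

/-! ### The framed braid group -/

namespace Framed

variable {d n : ℕ}

/-! The mirror image of a Markov trace is again a Markov trace. Put `h = q - q⁻¹`. The quadratic
relation gives `σ⁻¹ = σ - h e`, so composing with `σ ↦ σ⁻¹` replaces `h` by `-h`, that is `q` by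
`q⁻¹`. It also replaces `z` by `z - h E_D`, because the trace of `a e_n` is `E_D` times that of `a`
(`IsMarkovFn.comp_mirror`, `univ_idem`). Uniqueness of the trace then gives the theorem.

The bulk of the work is that the trace exists and is unique. Traces are studied as functions on
framed braids. By induction on the strands, the rules reduce every value to a polynomial in `h` and
`z` that does not depend on the function (`IsReducible.apply_mem`, `exists_poly`); this is
uniqueness.

For existence, a coloured R-matrix acts on words with `N` letters for each colour in `D`. Its trace,
twisted by suitable letter weights, obeys the rules for particular values of `z`
(`isMarkovFn_tensorTrace`). The parameters obtained from integers `q ≥ 2` and all `N ≥ 1` are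
Zariski dense in the `(h, z)`-plane (`eq_of_evalEval_eq`). Hence the polynomials of `exists_poly`
satisfy the rules identically (`isMarkovFn_univ`), and `Y.exists_linearMap` carries them to the
algebra. -/

theorem induction_on {p : Framed d n → Prop} (x : Framed d n) (one : p 1)
    (sigma : ∀ i, p (sigma i)) (t : ∀ j, p (t j)) (mul : ∀ a b, p a → p b → p (a * b))
    (inv : ∀ a, p a → p a⁻¹) : p x := by
  have hx : x ∈ Subgroup.closure
      (Set.range (PresentedGroup.of (rels := {r | FramedRel d n r}))) := by
    rw [PresentedGroup.closure_range_of]; trivial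
  induction hx using Subgroup.closure_induction with
  | mem y hy =>
    obtain ⟨g, rfl⟩ := hy
    cases g with
    | sigma i => exact sigma i
    | t j => exact t j
  | one => exact one
  | mul a b _ _ ha hb => exact mul a b ha hb
  | inv a _ ha => exact inv a ha

/-- The element `t_i^s t_{i+1}^{-s}`. -/
def tt (i : Fin (n - 1)) (s : ℕ) : Framed d n := t (lo i) ^ s * (t (hi i) ^ s)⁻¹

theorem commute_t (i j : Fin n) : Commute (t i : Framed d n) (t j) := t_comm i j

theorem t_lo_sigma (i : Fin (n - 1)) : (t (lo i) * sigma i : Framed d n) = sigma i * t (hi i) := by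
  rw [t_sigma, Equiv.swap_apply_left]

theorem t_hi_sigma (i : Fin (n - 1)) : (t (hi i) * sigma i : Framed d n) = sigma i * t (lo i) := by
  rw [t_sigma, Equiv.swap_apply_right]

theorem t_lo_pow_sigma (i : Fin (n - 1)) (s : ℕ) :
    (t (lo i) ^ s * sigma i : Framed d n) = sigma i * t (hi i) ^ s :=
  (SemiconjBy.pow_right (show SemiconjBy (sigma i : Framed d n) (t (hi i)) (t (lo i)) from
    (t_lo_sigma i).symm) s).symm

theorem t_hi_pow_sigma (i : Fin (n - 1)) (s : ℕ) :
    (t (hi i) ^ s * sigma i : Framed d n) = sigma i * t (lo i) ^ s :=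
  (SemiconjBy.pow_right (show SemiconjBy (sigma i : Framed d n) (t (lo i)) (t (hi i)) from
    (t_hi_sigma i).symm) s).symm

theorem t_hi_pow_inv_sigma (i : Fin (n - 1)) (s : ℕ) :
    ((t (hi i) ^ s)⁻¹ * sigma i : Framed d n) = sigma i * (t (lo i) ^ s)⁻¹ := by
  rw [inv_mul_eq_iff_eq_mul, ← mul_assoc, t_hi_pow_sigma, mul_inv_cancel_right]

theorem commute_t_last_succ (x : Framed d n) : Commute (t (Fin.last n)) (succ d n x) := by
  induction x using induction_on with
  | one => simp
  | sigma i =>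
    rw [succ_sigma, Commute, SemiconjBy, t_sigma, Equiv.swap_apply_of_ne_of_ne] <;>
    · simp only [lo, hi, up, Fin.last, ne_eq, Fin.mk.injEq]; omega
  | t j => rw [succ_t]; exact commute_t _ _
  | mul a b ha hb => rw [map_mul]; exact ha.mul_right hb
  | inv a ha => rw [map_inv]; exact ha.inv_right

theorem commute_sigma_succ_succ (x : Framed d n) :
    Commute (sigma ⟨n, by omega⟩ : Framed d (n + 2)) (succ d (n + 1) (succ d n x)) := by
  induction x using induction_on with
  | one => simp
  | sigma i =>
    rw [succ_sigma, succ_sigma]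
    exact (sigma_comm _ _ (by simp only [up]; omega)).symm
  | t j =>
    rw [succ_t, succ_t, Commute, SemiconjBy, t_sigma, Equiv.swap_apply_of_ne_of_ne] <;>
    · simp only [lo, hi, ne_eq, Fin.ext_iff, Fin.val_castSucc]; omega
  | mul a b ha hb => rw [map_mul, map_mul]; exact ha.mul_right hb
  | inv a ha => rw [map_inv, map_inv]; exact ha.inv_right

theorem succ_tt (i : Fin (n - 1)) (s : ℕ) : succ d n (tt i s) = tt (up i) s := by
  simp only [tt, map_mul, map_inv, map_pow, succ_t]; rfl

theorem t_inv [NeZero d] (j : Fin n) : (t j : Framed d n)⁻¹ = t j ^ (d - 1) := by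
  rw [inv_eq_iff_mul_eq_one, ← pow_succ', Nat.sub_add_cancel (NeZero.one_le), t_pow]

/-- A braiding generator on one more strand is an old one or the last one. -/
theorem sigma_cases (i : Fin (n + 1 - 1)) :
    (∃ j : Fin (n - 1), i = up j) ∨ (i : ℕ) + 1 = n := by
  by_cases h : (i : ℕ) + 1 = n
  · exact .inr h
  · exact .inl ⟨⟨i, by omega⟩, rfl⟩

theorem eq_last (i : Fin (n + 2 - 1)) (hi : (i : ℕ) + 1 = n + 1) : i = ⟨n, n.lt_succ_self⟩ :=
  Fin.ext (by simpa using hi)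

end Framed

/-! ### Functions on framed braids that respect the quadratic relations -/

section Quad

open Framed

variable {d n : ℕ} {M : Type*} [CommRing M]

/-- The function `ψ` respects the relations `σ_i² = 1 + H ∑_s t_i^s t_{i+1}^{-s} σ_i`. -/
def IsQuad (H : M) (ψ : Framed d n → M) : Prop :=
  ∀ (i : Fin (n - 1)) (a b : Framed d n), ψ (a * sigma i ^ 2 * b) =
    ψ (a * b) + H * ∑ s ∈ Finset.Icc 1 d, ψ (a * tt i s * sigma i * b)

theorem IsQuad.translate {H : M} {ψ : Framed d n → M} (hψ : IsQuad H ψ) (x y : Framed d n) :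
    IsQuad H fun a => ψ (x * a * y) := by
  intro i a b
  simpa only [mul_assoc] using hψ i (x * a) (b * y)

theorem IsQuad.comp_succ {H : M} {ψ : Framed d (n + 1) → M} (hψ : IsQuad H ψ) :
    IsQuad H fun a => ψ (succ d n a) := by
  intro i a b
  simpa only [map_mul, map_pow, succ_sigma, succ_tt] using hψ (up i) (succ d n a) (succ d n b)

/-- This is the quadratic relation divided by `σ_i`: replace `b` by `σ_i⁻¹ b`. -/
theorem IsQuad.apply_inv {H : M} {ψ : Framed d n → M} (hψ : IsQuad H ψ) (i : Fin (n - 1))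
    (a b : Framed d n) : ψ (a * (sigma i)⁻¹ * b) =
      ψ (a * sigma i * b) - H * ∑ s ∈ Finset.Icc 1 d, ψ (a * tt i s * b) := by
  have := hψ i a ((sigma i)⁻¹ * b)
  simp only [pow_two, mul_assoc, mul_inv_cancel_left] at this
  simp only [mul_assoc, this, add_sub_cancel_right]

/-- The function `ψ` on `F_{d,n+1}` respects the quadratic relations and takes values in `P` on the
framed braids `a t_{n+1}^s` and `a σ_n b` with `a, b ∈ F_{d,n}`. -/
structure IsReducible (P : Subring M) (H : M) (ψ : Framed d (n + 1) → M) : Prop where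
  quad : IsQuad H ψ
  framing : ∀ (a : Framed d n) (s : ℕ), ψ (succ d n a * t (Fin.last n) ^ s) ∈ P
  braiding : ∀ i : Fin (n + 1 - 1), (i : ℕ) + 1 = n → ∀ a b : Framed d n,
    ψ (succ d n a * sigma i * succ d n b) ∈ P

/-! ### Stability of reducible functions under right translation -/

variable {P : Subring M} {H : M}

theorem IsReducible.mul_succ {ψ : Framed d (n + 1) → M} (hψ : IsReducible P H ψ)
    (x : Framed d n) : IsReducible P H fun a => ψ (a * succ d n x) where
  quad := by simpa using hψ.quad.translate 1 (succ d n x)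
  framing a s := by
    rw [mul_assoc, ((commute_t_last_succ x).pow_left s).eq, ← mul_assoc, ← map_mul]
    exact hψ.framing _ s
  braiding i hi a b := by
    rw [mul_assoc, ← map_mul]
    exact hψ.braiding i hi _ _

/-- Moved to the left through `σ_n`, the last framing generator becomes `t_n`, which lives on the
first `n` strands. -/
theorem IsReducible.mul_t_last {ψ : Framed d (n + 1) → M} (hψ : IsReducible P H ψ) :
    IsReducible P H fun a => ψ (a * t (Fin.last n)) where
  quad := by simpa using hψ.quad.translate 1 (t (Fin.last n))
  framing a s := by
    rw [mul_assoc, ← pow_succ]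
    exact hψ.framing _ _
  braiding i hi a b := by
    obtain ⟨m, rfl⟩ : ∃ m, n = m + 1 := ⟨i, hi.symm⟩
    have h1 : t (Fin.last (m + 1)) = (t (YokonumaHecke.hi i) : Framed d (m + 2)) := by
      congr 1; ext; simp [YokonumaHecke.hi, hi]
    have h2 : (t (lo i) : Framed d (m + 2)) = succ d (m + 1) (t (Fin.last m)) := by
      rw [succ_t]; congr 1; ext; simp [lo]; omega
    have : succ d (m + 1) a * sigma i * succ d (m + 1) b * t (Fin.last (m + 1)) =
        succ d (m + 1) (a * t (Fin.last m)) * sigma i * succ d (m + 1) b := by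
      rw [mul_assoc, ← (commute_t_last_succ b).eq, ← mul_assoc, map_mul, ← h2,
        mul_assoc (succ d (m + 1) a) (t (lo i)), h1, t_lo_sigma, ← mul_assoc]
    rw [this]
    exact hψ.braiding i hi _ _

theorem IsReducible.mul_t_last_pow {ψ : Framed d (n + 1) → M} (hψ : IsReducible P H ψ) (s : ℕ) :
    IsReducible P H fun a => ψ (a * t (Fin.last n) ^ s) := by
  induction s with
  | zero => simpa using hψ
  | succ s ih => simpa only [pow_succ', mul_assoc] using ih.mul_t_last

/-- The only translation that needs the induction on strands. For fixed `a`, the function `b ↦ ψ (a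
σ b σ)`, with `σ` the last braiding generator, is itself reducible on one strand fewer, so the
induction hypothesis `ih` applies to it. -/
theorem IsReducible.mul_sigma {n : ℕ} (ih : ∀ ψ : Framed d (n + 1) → M, IsReducible P H ψ →
      ∀ x, ψ x ∈ P) (hH : H ∈ P) {ψ : Framed d (n + 2) → M} (hψ : IsReducible P H ψ) :
    IsReducible P H fun a => ψ (a * sigma ⟨n, by omega⟩) := by
  have hlast : t (Fin.last (n + 1)) = (t (hi ⟨n, by omega⟩) : Framed d (n + 2)) := rfl
  have hlo : (t (lo ⟨n, by omega⟩) : Framed d (n + 2)) = succ d (n + 1) (t (Fin.last n)) := by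
    rw [succ_t]; rfl
  refine ⟨by simpa using hψ.quad.translate 1 _, fun a s => ?_, fun i hi a b => ?_⟩
  · rw [mul_assoc, hlast, t_hi_pow_sigma, ← mul_assoc, hlo, ← map_pow]
    exact hψ.braiding _ rfl _ _
  · obtain rfl := eq_last i hi
    refine ih (fun b => ψ (succ d (n + 1) a * sigma ⟨n, by omega⟩ * succ d (n + 1) b *
      sigma ⟨n, by omega⟩)) ⟨?_, fun c s => ?_, fun j hj c c' => ?_⟩ b
    · exact (hψ.quad.translate (succ d (n + 1) a * sigma ⟨n, by omega⟩)
        (sigma ⟨n, by omega⟩)).comp_succ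
    -- Here `σ` commutes with `c` and moves the framing to the last strand, so a factor `σ²`
    -- appears; the quadratic relation leaves at most one `σ` in each term.
    · have h1 : succ d (n + 1) a * sigma ⟨n, by omega⟩ *
          succ d (n + 1) (succ d n c * t (Fin.last n) ^ s) * sigma ⟨n, by omega⟩ =
          succ d (n + 1) (a * succ d n c) * sigma ⟨n, by omega⟩ ^ 2 *
            t (Fin.last (n + 1)) ^ s := by
        rw [map_mul, map_pow, ← hlo, mul_assoc, mul_assoc (succ d (n + 1) (succ d n c)),
          t_lo_pow_sigma, ← hlast, ← mul_assoc, ← mul_assoc, mul_assoc (succ d (n + 1) a),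
          (commute_sigma_succ_succ c).eq, map_mul, pow_two]
        simp only [mul_assoc]
      rw [h1, hψ.quad]
      refine add_mem (hψ.framing _ _) (mul_mem hH (sum_mem fun r _ => ?_))
      have h2 : succ d (n + 1) (a * succ d n c) * tt ⟨n, by omega⟩ r * sigma ⟨n, by omega⟩ *
            t (Fin.last (n + 1)) ^ s =
          succ d (n + 1) (a * succ d n c * t (Fin.last n) ^ (r + s)) * sigma ⟨n, by omega⟩ *
            succ d (n + 1) (t (Fin.last n) ^ r)⁻¹ := by
        have hc : Commute (t (Fin.last (n + 1)) ^ s : Framed d (n + 2))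
            (t (lo ⟨n, by omega⟩) ^ r)⁻¹ := ((commute_t _ _).pow_pow s r).inv_right
        rw [tt, mul_assoc _ _ (sigma _), mul_assoc (t _ ^ r), t_hi_pow_inv_sigma, mul_assoc,
          mul_assoc (t _ ^ r), mul_assoc (sigma _), ← hc.eq, ← mul_assoc (sigma _), hlast,
          ← t_lo_pow_sigma, map_mul _ _ (t _ ^ _), map_pow, ← hlo, map_inv, map_pow, ← hlo,
          pow_add]
        simp only [mul_assoc]
      rw [h2]
      exact hψ.braiding _ rfl _ _
    -- The two copies of `σ` commute with `c` and `c'` and meet around `σ_j`; the braid relation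
    -- then leaves a single `σ`.
    · have h1 : succ d (n + 1) a * sigma ⟨n, by omega⟩ *
          succ d (n + 1) (succ d n c * sigma j * succ d n c') * sigma ⟨n, by omega⟩ =
          succ d (n + 1) (a * succ d n c * sigma j) * sigma ⟨n, by omega⟩ *
            succ d (n + 1) (sigma j * succ d n c') := by
        have hb := sigma_braid (d := d) (n := n + 2) (up j) ⟨n, by omega⟩ hj
        simp only [map_mul, succ_sigma]
        set x : Framed d (n + 2) := sigma ⟨n, by omega⟩
        calc _ = succ d (n + 1) a * (x * succ d (n + 1) (succ d n c)) * sigma (up j) *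
              (succ d (n + 1) (succ d n c') * x) := by simp only [mul_assoc]
          _ = succ d (n + 1) a * succ d (n + 1) (succ d n c) * (x * sigma (up j) * x) *
              succ d (n + 1) (succ d n c') := by
            rw [(commute_sigma_succ_succ c).eq, ← (commute_sigma_succ_succ c').eq]
            simp only [mul_assoc, x]
          _ = _ := by rw [← hb]; simp only [mul_assoc]
      rw [h1]
      exact hψ.braiding _ rfl _ _

/-- The inverse translation is carried along so that the induction on `x` passes through inverses.
Inverses of `t_j` are positive powers since `t_j ^ d = 1`; those of `σ_i` come from
`IsQuad.apply_inv`. -/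
theorem IsReducible.mul_right [NeZero d] {ψ : Framed d (n + 1) → M} (hψ : IsReducible P H ψ)
    (hH : H ∈ P) (hσ : ∀ i : Fin (n + 1 - 1), (i : ℕ) + 1 = n →
      ∀ ψ : Framed d (n + 1) → M, IsReducible P H ψ → IsReducible P H fun a => ψ (a * sigma i))
    (x : Framed d (n + 1)) : IsReducible P H (fun a => ψ (a * x)) ∧
      IsReducible P H (fun a => ψ (a * x⁻¹)) := by
  have hσ' : ∀ i (ψ : Framed d (n + 1) → M), IsReducible P H ψ →
      IsReducible P H fun a => ψ (a * sigma i) := by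
    intro i ψ hψ
    obtain ⟨j, rfl⟩ | h := sigma_cases i
    · rw [← succ_sigma]; exact hψ.mul_succ _
    · exact hσ i h ψ hψ
  have ht : ∀ j (s : ℕ) (ψ : Framed d (n + 1) → M), IsReducible P H ψ →
      IsReducible P H fun a => ψ (a * t j ^ s) := by
    intro j s ψ hψ
    induction j using Fin.lastCases with
    | last => exact hψ.mul_t_last_pow s
    | cast j => rw [← succ_t, ← map_pow]; exact hψ.mul_succ _
  have htinv : ∀ j (s : ℕ) (ψ : Framed d (n + 1) → M), IsReducible P H ψ →
      IsReducible P H fun a => ψ (a * (t j ^ s)⁻¹) := by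
    intro j s ψ hψ
    rw [← inv_pow, t_inv, ← pow_mul]
    exact ht _ _ ψ hψ
  induction x using induction_on generalizing ψ with
  | one => simpa using hψ
  | sigma i =>
    refine ⟨hσ' i ψ hψ, ?_⟩
    have key : ∀ a, ψ (a * (sigma i)⁻¹) =
        ψ (a * sigma i) - H * ∑ s ∈ Finset.Icc 1 d, ψ (a * tt i s) := fun a => by
      simpa using hψ.quad.apply_inv i a 1
    have htt : ∀ s, IsReducible P H fun a => ψ (a * tt i s) := fun s => by
      simpa only [tt, mul_assoc] using ht (lo i) s _ (htinv (YokonumaHecke.hi i) s ψ hψ)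
    refine ⟨by simpa using hψ.quad.translate 1 _, fun a s => ?_, fun j hj a b => ?_⟩
    · rw [key]
      exact sub_mem ((hσ' i ψ hψ).framing _ _)
        (mul_mem hH (sum_mem fun r _ => (htt r).framing _ _))
    · rw [key]
      exact sub_mem ((hσ' i ψ hψ).braiding _ hj _ _)
        (mul_mem hH (sum_mem fun r _ => (htt r).braiding _ hj _ _))
  | t j => exact ⟨by simpa using ht j 1 ψ hψ, by simpa using htinv j 1 ψ hψ⟩
  | mul x y hx hy =>
    refine ⟨by simpa only [mul_assoc] using (hx (hy hψ).1).1, ?_⟩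
    simpa only [mul_inv_rev, mul_assoc] using (hy (hx hψ).2).2
  | inv x hx => exact ⟨(hx hψ).2, by simpa using (hx hψ).1⟩

/-- Dual form of the fact that `Y_{d,n+1}` is spanned by the `Y_{d,n} t_{n+1}^s` and `Y_{d,n} g_n
Y_{d,n}`: translate `ψ` by `x` and evaluate at `1`. -/
theorem IsReducible.apply_mem [NeZero d] (hH : H ∈ P) {ψ : Framed d (n + 1) → M}
    (hψ : IsReducible P H ψ) (x : Framed d (n + 1)) : ψ x ∈ P := by
  induction n with
  | zero => simpa using (hψ.mul_right hH (fun i hi => absurd hi (by omega)) x).1.framing 1 0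
  | succ n ih =>
    suffices h : _ from by simpa using (hψ.mul_right hH h x).1.framing 1 0
    intro i hi ψ hψ
    obtain rfl := eq_last i hi
    exact hψ.mul_sigma (fun ψ hψ x => ih hψ x) hH

end Quad

/-! ### Markov functions on framed braids -/

open Framed in
/-- The rules of the Markov trace for families of complex-valued functions on the framed braid
groups, with parameters `h = q - q⁻¹`, `z` and `x_s`. -/
structure IsMarkovFn (d : ℕ) (x : ZMod d → ℂ) (h z : ℂ) (φ : ∀ n, Framed d n → ℂ) : Prop where
  one : φ 0 1 = 1
  trace : ∀ n a b, φ n (a * b) = φ n (b * a)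
  markov : ∀ n (a : Framed d (n + 1)),
    φ (n + 2) (succ d (n + 1) a * sigma ⟨n, by omega⟩) = z * φ (n + 1) a
  framing : ∀ n (a : Framed d n) (s : ℕ),
    φ (n + 1) (succ d n a * t (Fin.last n) ^ s) = x s * φ n a
  quad : ∀ n, IsQuad (h / d) (φ n)

/-- The value of Markov functions at a framed braid is a polynomial in the parameters. -/
theorem exists_poly {d : ℕ} [NeZero d] (x : ZMod d → ℂ) {n : ℕ} (α : Framed d n) :
    ∃ p : ℂ[X][X], ∀ h z φ, IsMarkovFn d x h z φ → φ n α = p.evalEval h z := by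
  -- `J` collects all Markov functions with all their parameters. Working in the ring `J → ℂ`, with
  -- the range of evaluation as the subring, yields one polynomial that serves them all.
  let J := {j : ℂ × ℂ × (∀ n, Framed d n → ℂ) // IsMarkovFn d x j.1 j.2.1 j.2.2}
  let ev : ℂ[X][X] →+* (J → ℂ) := RingHom.pi fun j => evalEvalRingHom j.1.1 j.1.2.1
  have hev : ∀ p j, ev p j = p.evalEval j.1.1 j.1.2.1 := fun p j => rfl
  suffices h : (fun j : J => j.1.2.2 n α) ∈ ev.range by
    obtain ⟨p, hp⟩ := h
    refine ⟨p, fun h z φ hφ => ?_⟩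
    simpa [hev] using (congrFun hp ⟨(h, z, φ), hφ⟩).symm
  have hC : ∀ c : ℂ, (fun _ : J => c) ∈ ev.range := fun c => ⟨C (C c), by ext; simp [hev]⟩
  have hz : (fun j : J => j.1.2.1) ∈ ev.range := ⟨X, by ext; simp [hev]⟩
  have hh : (fun j : J => j.1.1 / (d : ℂ)) ∈ ev.range :=
    ⟨C (X * C (d : ℂ)⁻¹), by ext; simp only [hev, evalEval_C]; simp [div_eq_inv_mul]⟩
  induction n with
  | zero =>
    have : α = 1 := by
      induction α using Framed.induction_on with
      | one => rfl
      | sigma i => exact i.elim0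
      | t j => exact j.elim0
      | mul a b ha hb => rw [ha, hb, mul_one]
      | inv a ha => rw [ha, inv_one]
    rw [this]
    convert hC 1 with j
    exact j.2.one
  | succ n ih =>
    refine IsReducible.apply_mem (ψ := fun α j => j.1.2.2 (n + 1) α) hh ⟨?_, ?_, ?_⟩ α
    · intro i a b
      ext j
      simpa using j.2.quad _ i a b
    · intro a s
      convert mul_mem (hC (x s)) (ih a) with j
      exact j.2.framing _ _ _
    · intro i hi a b
      obtain ⟨m, rfl⟩ : ∃ m, n = m + 1 := ⟨i, hi.symm⟩
      obtain rfl := Framed.eq_last i hi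
      -- Cyclicity turns `a σ b` into `b a σ`, to which the Markov rule applies.
      convert mul_mem hz (ih (b * a)) with j
      rw [j.2.trace, ← mul_assoc, ← map_mul, j.2.markov]
      rfl

end YokonumaHecke

namespace YokonumaHecke

noncomputable section

/-! ### The coloured R-matrix -/

section RMatrix

variable {d : ℕ} {D : Finset (ZMod d)} {N n : ℕ}

/-- The basis of the tensor factors: `N` letters of each colour in `D`. -/
abbrev Letter (D : Finset (ZMod d)) (N : ℕ) : Type := D × Fin N

/-- The functions on the words of length `n` in the letters. -/
abbrev WordFn (D : Finset (ZMod d)) (N n : ℕ) : Type := (Fin n → Letter D N) → ℂ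

/-- The entry of the R-matrix that interchanges the letters `a` and `b`. -/
def swapCoeff (q : ℂ) (a b : Letter D N) : ℂ := if a = b then q else 1

/-- The diagonal entry of the R-matrix at distinct letters `a` and `b`. -/
def stayCoeff (q : ℂ) (a b : Letter D N) : ℂ := if a.1 = b.1 ∧ b.2 < a.2 then q - q⁻¹ else 0

/-- The R-matrix acting at the positions `k` and `l`. -/
def rOp (q : ℂ) (k l : Fin n) : Module.End ℂ (WordFn D N n) where
  toFun f w := swapCoeff q (w k) (w l) * f (w ∘ Equiv.swap k l) + stayCoeff q (w k) (w l) * f w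
  map_add' f g := by ext w; simp only [Pi.add_apply]; ring
  map_smul' c f := by ext w; simp only [Pi.smul_apply, smul_eq_mul, RingHom.id_apply]; ring

theorem rOp_apply (q : ℂ) (k l : Fin n) (f : WordFn D N n) (w : Fin n → Letter D N) :
    rOp q k l f w =
      swapCoeff q (w k) (w l) * f (w ∘ Equiv.swap k l) + stayCoeff q (w k) (w l) * f w := rfl

/-- The diagonal operators. -/
def diag (D : Finset (ZMod d)) (N n : ℕ) : WordFn D N n →ₐ[ℂ] Module.End ℂ (WordFn D N n) :=
  Algebra.lmul ℂ _

theorem diag_apply (u f : WordFn D N n) (w : Fin n → Letter D N) :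
    diag D N n u f w = u w * f w := rfl

/-- The indicator function of the words with letters of the same colour at `k` and `l`. -/
def sameColour (k l : Fin n) : WordFn D N n := fun w => if (w k).1 = (w l).1 then 1 else 0

/-! ### The quadratic relation and the Yang-Baxter equation for the R-matrix -/

@[simp] theorem swapCoeff_self (q : ℂ) (a : Letter D N) : swapCoeff q a a = q := if_pos rfl

theorem swapCoeff_of_ne (q : ℂ) {a b : Letter D N} (h : a ≠ b) : swapCoeff q a b = 1 := if_neg h

@[simp] theorem stayCoeff_self (q : ℂ) (a : Letter D N) : stayCoeff q a a = 0 := by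
  simp [stayCoeff]

theorem stayCoeff_sq (q : ℂ) (a b : Letter D N) :
    stayCoeff q a b ^ 2 = (q - q⁻¹) * stayCoeff q a b := by
  unfold stayCoeff; split_ifs <;> ring

theorem swap_swap_comp {A : Type*} (k l : Fin n) (w : Fin n → A) :
    (w ∘ Equiv.swap k l) ∘ Equiv.swap k l = w := by
  ext; simp

theorem comp_swap_of_eq {A : Type*} {k l : Fin n} {w : Fin n → A} (h : w k = w l) :
    w ∘ Equiv.swap k l = w := by
  ext j
  by_cases hk : j = k
  · simp [hk, h]
  · by_cases hl : j = l
    · simp [hl, h]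
    · simp [Equiv.swap_apply_of_ne_of_ne hk hl]

/-- Only the two letters matter. Equal letters give `q² = 1 + (q - q⁻¹) q`. Distinct letters of one
colour give a Hecke block, with exactly one nonzero diagonal entry. Letters of different colours are
merely interchanged. -/
theorem rOp_sq {q : ℂ} (hq : q ≠ 0) (k l : Fin n) :
    rOp q k l * rOp q k l = 1 + (q - q⁻¹) • (diag D N n (sameColour k l) * rOp q k l) := by
  refine LinearMap.ext fun f => funext fun w => ?_
  simp only [Module.End.mul_apply, LinearMap.add_apply, LinearMap.smul_apply, Module.End.one_apply,
    Pi.add_apply, Pi.smul_apply, smul_eq_mul, diag_apply, rOp_apply, swap_swap_comp, sameColour,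
    Function.comp_apply, Equiv.swap_apply_left, Equiv.swap_apply_right]
  by_cases h : w k = w l
  · rw [comp_swap_of_eq h, h]
    simp only [swapCoeff_self, stayCoeff_self, if_true]
    field_simp
    ring
  · rw [swapCoeff_of_ne q h, swapCoeff_of_ne q (Ne.symm h)]
    by_cases hc : (w k).1 = (w l).1
    · have h2 : (w k).2 ≠ (w l).2 := fun h' => h (Prod.ext hc h')
      rcases lt_or_gt_of_ne h2 with h3 | h3
      · simp [stayCoeff, hc, h3, h3.not_gt]
      · simp [stayCoeff, hc, h3, h3.not_gt]
    · simp [stayCoeff, hc, Ne.symm hc]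

theorem commute_diag_rOp (q : ℂ) (k l : Fin n) {u : WordFn D N n}
    (hu : ∀ w, u (w ∘ Equiv.swap k l) = u w) : Commute (diag D N n u) (rOp q k l) := by
  refine LinearMap.ext fun f => funext fun w => ?_
  simp only [Module.End.mul_apply, diag_apply, rOp_apply, hu]
  ring

theorem sameColour_swap (k l : Fin n) (w : Fin n → Letter D N) :
    sameColour k l (w ∘ Equiv.swap k l) = sameColour k l w := by
  simp [sameColour, eq_comm]

/-- The word `w` with its letters at the positions `k`, `l`, `m` replaced. -/
def replace {A : Type*} (w : Fin n → A) (k l m : Fin n) (a b c : A) : Fin n → A :=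
  Function.update (Function.update (Function.update w m c) l b) k a

/-- Within one colour: if `c` lies below both `a` and `b`, then either `c < a < b` or `c < b < a`.
With different colours both sides vanish. -/
theorem stayCoeff_rel (q : ℂ) (a b c : Letter D N) (h : a ≠ b) :
    stayCoeff q a c * stayCoeff q b a + stayCoeff q a b * stayCoeff q b c =
      stayCoeff q b c * stayCoeff q a c := by
  obtain ⟨a1, a2⟩ := a
  obtain ⟨b1, b2⟩ := b
  obtain ⟨c1, c2⟩ := c
  simp only [stayCoeff]
  by_cases h1 : a1 = b1
  · subst h1
    by_cases h2 : a1 = c1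
    · subst h2
      have h3 : a2 ≠ b2 := fun h3 => h (by rw [h3])
      rcases lt_or_gt_of_ne h3 with h3 | h3
      · by_cases h4 : c2 < a2
        · simp [h3, h4, h3.not_gt, h4.trans h3]
        · simp [h3, h4, h3.not_gt]
      · by_cases h4 : c2 < b2
        · simp [h3, h4, h3.not_gt, h4.trans h3]
        · simp [h3, h4, h3.not_gt]
    · simp [h2]
  · by_cases h2 : a1 = c1
    · subst h2
      simp [h1, Ne.symm h1]
    · simp [h1, h2]

/-- The dual dichotomy: if `b` and `c` both lie below `a`, then either `b < c < a` or `c < b < a`.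
-/
theorem stayCoeff_rel' (q : ℂ) (a b c : Letter D N) (h : b ≠ c) :
    stayCoeff q a b * stayCoeff q a c =
      stayCoeff q a c * stayCoeff q c b + stayCoeff q b c * stayCoeff q a b := by
  obtain ⟨a1, a2⟩ := a
  obtain ⟨b1, b2⟩ := b
  obtain ⟨c1, c2⟩ := c
  simp only [stayCoeff]
  by_cases h1 : c1 = b1
  · subst h1
    by_cases h2 : a1 = c1
    · subst h2
      have h3 : b2 ≠ c2 := fun h3 => h (by rw [h3])
      rcases lt_or_gt_of_ne h3 with h3 | h3
      · by_cases h4 : c2 < a2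
        · simp [h3, h4, h3.not_gt, h3.trans h4]
        · simp [h3, h4, h3.not_gt]
      · by_cases h4 : b2 < a2
        · simp [h3, h4, h3.not_gt, h3.trans h4]
        · simp [h3, h4, h3.not_gt]
    · simp [h2]
  · by_cases h2 : a1 = c1
    · subst h2
      simp [h1, Ne.symm h1]
    · simp [h1, h2, Ne.symm h1]

/-- The Yang-Baxter equation for the entries of the R-matrix. -/
theorem yangBaxter {q : ℂ} (hq : q ≠ 0) (F : Letter D N → Letter D N → Letter D N → ℂ)
    (a b c : Letter D N) :
    let γ := swapCoeff (D := D) (N := N) q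
    let β := stayCoeff (D := D) (N := N) q
    γ a b * (γ a c * (γ b c * F c b a + β b c * F b c a) +
        β a c * (γ b a * F a b c + β b a * F b a c)) +
      β a b * (γ b c * (γ a c * F c a b + β a c * F a c b) +
        β b c * (γ a b * F b a c + β a b * F a b c)) =
    γ b c * (γ a c * (γ a b * F c b a + β a b * F c a b) +
        β a c * (γ c b * F a b c + β c b * F a c b)) +
      β b c * (γ a b * (γ a c * F b c a + β a c * F b a c) +
        β a b * (γ b c * F a c b + β b c * F a b c)) := by
  intro γ β
  have hsq := stayCoeff_sq (D := D) (N := N) q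
  -- For adjacent equal letters the equation comes down to `q β² + β = q² β`, which follows from
  -- this and `hsq`.
  have hqq : q * (q - q⁻¹) = q ^ 2 - 1 := by field_simp
  by_cases hab : a = b
  · subst hab
    by_cases hac : a = c
    · subst hac; rfl
    · simp only [γ, β, swapCoeff_self, stayCoeff_self, swapCoeff_of_ne q hac,
        swapCoeff_of_ne q (Ne.symm hac)]
      have h0 : stayCoeff q a c * stayCoeff q c a = 0 := by
        have := stayCoeff_rel q c a c (Ne.symm hac)
        simp only [stayCoeff_self] at this
        linear_combination this
      linear_combination (-(q * F a a c)) * hsq a c - stayCoeff q a c * F a a c * hqq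
        - h0 * F a c a
  · by_cases hbc : b = c
    · subst hbc
      simp only [γ, β, swapCoeff_self, stayCoeff_self, swapCoeff_of_ne q hab,
        swapCoeff_of_ne q (Ne.symm hab)]
      have h0 : stayCoeff q a b * stayCoeff q b a = 0 := by
        have := stayCoeff_rel q a b b hab
        simp only [stayCoeff_self] at this
        linear_combination this
      linear_combination (q * F a b b) * hsq a b + stayCoeff q a b * F a b b * hqq
        + h0 * F b a b
    · have e1 := stayCoeff_rel q a b c hab
      have e2 := stayCoeff_rel' q a b c hbc
      simp only [γ, β]
      by_cases hac : a = c
      · subst hac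
        simp only [swapCoeff_self, stayCoeff_self, swapCoeff_of_ne q hab,
          swapCoeff_of_ne q (Ne.symm hab)] at e1 e2 ⊢
        linear_combination F b a a * e1 + F a a b * e2 +
          F a b a * (stayCoeff q b a * hsq a b - stayCoeff q a b * hsq b a)
      · simp only [swapCoeff_of_ne q hab, swapCoeff_of_ne q (Ne.symm hab), swapCoeff_of_ne q hac,
          swapCoeff_of_ne q hbc, swapCoeff_of_ne q (Ne.symm hbc)]
        linear_combination F b a c * e1 + F a c b * e2 +
          F a b c * (stayCoeff q b c * hsq a b - stayCoeff q a b * hsq b c)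

/-- With the rest of the word fixed, both sides involve only the letters at `k`, `l`, `m`, and `f`
becomes a function of three letters. -/
theorem rOp_braid {q : ℂ} (hq : q ≠ 0) {k l m : Fin n} (hkl : k ≠ l) (hlm : l ≠ m) (hkm : k ≠ m) :
    (rOp q k l * rOp q l m * rOp q k l : Module.End ℂ (WordFn D N n)) =
      rOp q l m * rOp q k l * rOp q l m := by
  have h1 : ∀ (w : Fin n → Letter D N) a b c,
      replace w k l m a b c ∘ Equiv.swap k l = replace w k l m b a c := by
    intro w a b c
    ext1 j
    simp only [replace, Function.comp_apply, Function.update_apply, Equiv.swap_apply_def]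
    grind
  have h2 : ∀ (w : Fin n → Letter D N) a b c,
      replace w k l m a b c ∘ Equiv.swap l m = replace w k l m a c b := by
    intro w a b c
    ext1 j
    simp only [replace, Function.comp_apply, Function.update_apply, Equiv.swap_apply_def]
    grind
  have v1 : ∀ (w : Fin n → Letter D N) a b c, replace w k l m a b c k = a := by
    intros; simp [replace]
  have v2 : ∀ (w : Fin n → Letter D N) a b c, replace w k l m a b c l = b := by
    intros; simp [replace, hkl.symm]
  have v3 : ∀ (w : Fin n → Letter D N) a b c, replace w k l m a b c m = c := by
    intros; simp [replace, hkm.symm, hlm.symm]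
  refine LinearMap.ext fun f => funext fun w => ?_
  have hw : w = replace w k l m (w k) (w l) (w m) := by simp [replace]
  rw [hw]
  generalize w k = a, w l = b, w m = c
  simp only [Module.End.mul_apply, rOp_apply, h1, h2, v1, v2, v3]
  exact yangBaxter hq (fun a b c => f (replace w k l m a b c)) a b c

theorem rOp_comm (q : ℂ) {k l k' l' : Fin n} (h1 : k ≠ k') (h2 : k ≠ l') (h3 : l ≠ k')
    (h4 : l ≠ l') : (rOp q k l * rOp q k' l' : Module.End ℂ (WordFn D N n)) =
      rOp q k' l' * rOp q k l := by
  refine LinearMap.ext fun f => funext fun w => ?_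
  have hs : (w ∘ Equiv.swap k l) ∘ Equiv.swap k' l' = (w ∘ Equiv.swap k' l') ∘ Equiv.swap k l := by
    ext1 j
    simp only [Function.comp_apply, Equiv.swap_apply_def]
    grind
  simp only [Module.End.mul_apply, rOp_apply, hs, Function.comp_apply,
    Equiv.swap_apply_of_ne_of_ne h1 h2, Equiv.swap_apply_of_ne_of_ne h3 h4,
    Equiv.swap_apply_of_ne_of_ne h1.symm h3.symm, Equiv.swap_apply_of_ne_of_ne h2.symm h4.symm]
  ring

/-! ### Partial traces over the last letter and the Markov weights -/

theorem snoc_castSucc_eq (w : Fin n → Letter D N) (a : Letter D N) (j : Fin n) :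
    (Fin.snoc w a : Fin (n + 1) → Letter D N) j.castSucc = w j := Fin.snoc_castSucc ..

theorem single_snoc (v w : Fin n → Letter D N) (a : Letter D N) :
    (Pi.single (Fin.snoc v a) 1 : WordFn D N (n + 1)) (Fin.snoc w a) = if w = v then 1 else 0 := by
  rw [Pi.single_apply]
  simp only [Fin.snoc_inj, and_true]

variable {q : ℂ}

theorem partial_trace_diag (μ : Letter D N → ℂ) (u : WordFn D N (n + 1)) (c : ℂ)
    (hu : ∀ w : Fin n → Letter D N, ∑ a, μ a * u (Fin.snoc w a) = c) (v w : Fin n → Letter D N) :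
    ∑ a, μ a * diag D N (n + 1) u (Pi.single (Fin.snoc v a) 1) (Fin.snoc w a) =
      if w = v then c else 0 := by
  simp only [diag_apply, single_snoc, ← mul_assoc, ← Finset.sum_mul, hu]
  simp

/-- The interchange term contributes only if `a` is the last letter of `w`, since the swapped word
ends in that letter. This is the summand `q * μ b` in `hμ`; the diagonal entries give the remaining
sum. -/
theorem partial_trace_rOp (μ : Letter D N → ℂ) (c : ℂ)
    (hμ : ∀ b, q * μ b + ∑ a, stayCoeff q b a * μ a = c) (v w : Fin (n + 1) → Letter D N) :
    ∑ a, μ a * rOp q (lo ⟨n, by omega⟩) (hi ⟨n, by omega⟩)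
        (Pi.single (Fin.snoc v a) 1) (Fin.snoc w a : Fin (n + 2) → Letter D N) =
      if w = v then c else 0 := by
  have hlo : ∀ a, (Fin.snoc w a : Fin (n + 2) → Letter D N) (lo ⟨n, by omega⟩) = w (Fin.last n) :=
    fun a => snoc_castSucc_eq w a (Fin.last n)
  have hhi : ∀ a, (Fin.snoc w a : Fin (n + 2) → Letter D N) (hi ⟨n, by omega⟩) = a :=
    fun a => Fin.snoc_last ..
  have hsw : ∀ a, swapCoeff q (w (Fin.last n)) a * (Pi.single (Fin.snoc v a) 1 : WordFn D N (n + 2))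
      ((Fin.snoc w a : Fin (n + 2) → Letter D N) ∘
        Equiv.swap (lo ⟨n, by omega⟩) (hi ⟨n, by omega⟩)) =
      if w (Fin.last n) = a then q * (if w = v then 1 else 0) else 0 := by
    intro a
    by_cases ha : w (Fin.last n) = a
    · rw [comp_swap_of_eq (by rw [hlo, hhi, ha]), single_snoc, if_pos ha, ha, swapCoeff_self]
    · rw [if_neg ha, Pi.single_eq_of_ne, mul_zero]
      intro h
      apply ha
      have := congrFun h (hi ⟨n, by omega⟩)
      rw [Function.comp_apply, Equiv.swap_apply_right, hlo] at this
      rw [this]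
      exact Fin.snoc_last ..
  simp only [rOp_apply, hlo, hhi, hsw, single_snoc]
  by_cases h : w = v
  · simp only [h, if_true, mul_one, mul_add, mul_ite, mul_zero, Finset.sum_add_distrib,
      Finset.sum_ite_eq, Finset.mem_univ]
    rw [← hμ (v (Fin.last n)), mul_comm]
    simp only [mul_comm]
  · simp [h]

/-- The weights of the letters for the Markov trace. -/
def letterWeight (q : ℂ) (a : Letter D N) : ℂ :=
  1 / (D.card : ℂ) * ((1 - q⁻¹ ^ 2) / (1 - (q⁻¹ ^ 2) ^ N)) * (q⁻¹ ^ 2) ^ (a.2 : ℕ)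

/-- The parameter `z` of the Markov trace on tensor space. -/
def zParam (D : Finset (ZMod d)) (N : ℕ) (q : ℂ) : ℂ :=
  q * (1 / (D.card : ℂ) * ((1 - q⁻¹ ^ 2) / (1 - (q⁻¹ ^ 2) ^ N)))

theorem sum_letterWeight (hN : (q⁻¹ ^ 2) ^ N ≠ 1) (c : D) :
    ∑ k : Fin N, letterWeight q (c, k) = 1 / (D.card : ℂ) := by
  have h : 1 - (q⁻¹ ^ 2) ^ N ≠ 0 := sub_ne_zero.mpr hN.symm
  simp only [letterWeight]
  rw [← Finset.mul_sum, Fin.sum_univ_eq_sum_range fun k => (q⁻¹ ^ 2) ^ k, mul_assoc,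
    div_mul_eq_mul_div (1 - _), mul_neg_geom_sum, div_self h, mul_one]

/-- Each colour has total weight `1 / |D|`, so the weights average functions of the colour over `D`.
This is the source of both `X_D` and `E_D`. -/
theorem sum_letterWeight_mul (hN : (q⁻¹ ^ 2) ^ N ≠ 1) (f : D → ℂ) :
    ∑ a : Letter D N, letterWeight q a * f a.1 = 1 / (D.card : ℂ) * ∑ c, f c := by
  rw [Fintype.sum_prod_type, Finset.mul_sum]
  simp only [← Finset.sum_mul, sum_letterWeight hN]

/-- The weights are geometric with ratio `q⁻²` and `q - q⁻¹ = q (1 - q⁻²)`, so the sum over the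
letters below `b` telescopes and the total does not depend on `b`. -/
theorem letterWeight_rel (hq : q ≠ 0) (b : Letter D N) :
    q * letterWeight q b + ∑ a, stayCoeff q b a * letterWeight q a = zParam D N q := by
  have h1 : ∑ a, stayCoeff q b a * letterWeight q a =
      (q - q⁻¹) * (1 / (D.card : ℂ) * ((1 - q⁻¹ ^ 2) / (1 - (q⁻¹ ^ 2) ^ N))) *
        ∑ k : Fin N, (if k < b.2 then (q⁻¹ ^ 2) ^ (k : ℕ) else 0) := by
    rw [Fintype.sum_prod_type, Finset.sum_eq_single b.1, Finset.mul_sum]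
    · refine Finset.sum_congr rfl fun k _ => ?_
      by_cases hk : k < b.2
      · simp only [stayCoeff, letterWeight, hk, and_self, if_true, mul_assoc]
      · simp [stayCoeff, hk]
    · intro c _ hc
      exact Finset.sum_eq_zero fun k _ => by simp [stayCoeff, Ne.symm hc]
    · simp
  have h2 : ∑ k : Fin N, (if k < b.2 then (q⁻¹ ^ 2) ^ (k : ℕ) else 0) =
      ∑ k ∈ Finset.range b.2, (q⁻¹ ^ 2) ^ k := by
    rw [← Finset.sum_filter]
    refine Finset.sum_nbij (fun k => (k : ℕ)) ?_ ?_ ?_ ?_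
    · intro k hk
      simpa using hk
    · intro k _ l _ h
      exact Fin.ext h
    · intro k hk
      have hk' : k < b.2 := by simpa using hk
      exact ⟨⟨k, hk'.trans b.2.2⟩,
        Finset.mem_coe.mpr (Finset.mem_filter.mpr ⟨Finset.mem_univ _, hk'⟩), rfl⟩
    · simp
  have h3 : q - q⁻¹ = q * (1 - q⁻¹ ^ 2) := by
    rw [pow_two, mul_sub, mul_one, mul_inv_cancel_left₀ hq]
  have h4 := mul_neg_geom_sum (q⁻¹ ^ 2) (b.2 : ℕ)
  rw [h1, h2, h3, letterWeight, zParam]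
  linear_combination q * (1 / (D.card : ℂ) * ((1 - q⁻¹ ^ 2) / (1 - (q⁻¹ ^ 2) ^ N))) * h4

/-! ### The framing operators and the representation of the framed braid group -/

variable [NeZero d]

/-- The character of the colour of the letter at `k`. -/
def colourChar (k : Fin n) : WordFn D N n := fun w => ZMod.stdAddChar ((w k).1 : ZMod d)

theorem colourChar_pow_apply (k : Fin n) (s : ℕ) (w : Fin n → Letter D N) :
    (colourChar k ^ s : WordFn D N n) w = ZMod.stdAddChar (((w k).1 : ZMod d) * (s : ZMod d)) := by
  rw [Pi.pow_apply, colourChar, ← AddChar.map_nsmul_eq_pow, nsmul_eq_mul, mul_comm]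

theorem colourChar_pow (k : Fin n) : (colourChar k : WordFn D N n) ^ d = 1 := by
  funext w
  rw [colourChar_pow_apply]
  simp

/-- The diagonal entries of the R-matrix vanish at letters of different colours, so staying in place
and being interchanged have the same effect on colours wherever both can occur. -/
theorem diag_colourChar_rOp (q : ℂ) (k l j : Fin n) :
    diag D N n (colourChar j) * rOp q k l =
      rOp q k l * diag D N n (colourChar (Equiv.swap k l j)) := by
  refine LinearMap.ext fun f => funext fun w => ?_
  simp only [Module.End.mul_apply, diag_apply, rOp_apply, colourChar, Function.comp_apply,
    Equiv.swap_apply_self]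
  by_cases h : (w k).1 = (w l).1
  · have : (w (Equiv.swap k l j)).1 = (w j).1 := by
      rw [Equiv.swap_apply_def]; split_ifs with h1 h2 <;> simp_all
    rw [this]
    ring
  · simp only [stayCoeff, h, false_and, if_false]
    ring

/-- The R-matrix as an invertible operator. -/
def rUnit {q : ℂ} (hq : q ≠ 0) (k l : Fin n) : (Module.End ℂ (WordFn D N n))ˣ where
  val := rOp q k l
  inv := rOp q k l - (q - q⁻¹) • diag D N n (sameColour k l)
  val_inv := by
    rw [mul_sub, rOp_sq hq, mul_smul_comm, ← (commute_diag_rOp q k l (sameColour_swap k l)).eq,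
      add_sub_cancel_right]
  inv_val := by
    rw [sub_mul, rOp_sq hq, smul_mul_assoc, add_sub_cancel_right]

/-- The framing generator as an invertible operator. -/
def tUnit (D : Finset (ZMod d)) (N : ℕ) (k : Fin n) : (Module.End ℂ (WordFn D N n))ˣ :=
  Units.map (diag D N n : WordFn D N n →* Module.End ℂ (WordFn D N n))
    (Units.ofPowEqOne (colourChar k) d (colourChar_pow k) (NeZero.ne d))

theorem val_tUnit (k : Fin n) : (tUnit D N k : Module.End ℂ (WordFn D N n)) =
    diag D N n (colourChar k) := rfl

/-- The action of the framed braid group on tensor space, by invertible operators. -/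
def repUnits (D : Finset (ZMod d)) (N : ℕ) {q : ℂ} (hq : q ≠ 0) (n : ℕ) :
    Framed d n →* (Module.End ℂ (WordFn D N n))ˣ :=
  PresentedGroup.toGroup
    (f := fun x => match x with
      | FramedGen.sigma i => rUnit hq (lo i) (hi i)
      | FramedGen.t j => tUnit D N j) (by
    rintro r (⟨i, j, h⟩ | ⟨i, j, h⟩ | ⟨i, j⟩ | ⟨i, j⟩ | ⟨j⟩)
    · simp only [map_mul, map_inv, FreeGroup.lift_apply_of, mul_inv_eq_one]
      have hij : lo j = hi i := Fin.ext h.symm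
      refine Units.ext ?_
      simp only [Units.val_mul, rUnit, hij]
      refine rOp_braid hq ?_ ?_ ?_ <;> simp only [lo, hi, ne_eq, Fin.mk.injEq] <;> omega
    · simp only [map_mul, map_inv, FreeGroup.lift_apply_of, mul_inv_eq_one]
      refine Units.ext (rOp_comm q ?_ ?_ ?_ ?_) <;>
        simp only [lo, hi, ne_eq, Fin.mk.injEq] <;> omega
    · simp only [map_mul, map_inv, FreeGroup.lift_apply_of, mul_inv_eq_one]
      refine Units.ext ?_
      simp only [Units.val_mul, val_tUnit, ← map_mul, mul_comm]
    · simp only [map_mul, map_inv, FreeGroup.lift_apply_of, mul_inv_eq_one]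
      exact Units.ext (diag_colourChar_rOp q _ _ _)
    · simp only [map_pow, FreeGroup.lift_apply_of]
      refine Units.ext ?_
      rw [Units.val_pow_eq_pow_val, val_tUnit, ← map_pow, colourChar_pow, map_one, Units.val_one])

/-- The representation of the framed braid group on tensor space. -/
def rep (D : Finset (ZMod d)) (N : ℕ) {q : ℂ} (hq : q ≠ 0) (n : ℕ) :
    Framed d n →* Module.End ℂ (WordFn D N n) :=
  (Units.coeHom _).comp (repUnits D N hq n)

variable (hq : q ≠ 0)

theorem repUnits_sigma (i : Fin (n - 1)) :
    repUnits D N hq n (Framed.sigma i) = rUnit hq (lo i) (hi i) := PresentedGroup.toGroup.of _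

theorem repUnits_t (j : Fin n) : repUnits D N hq n (Framed.t j) = tUnit D N j :=
  PresentedGroup.toGroup.of _

theorem rep_sigma (i : Fin (n - 1)) : rep D N hq n (Framed.sigma i) = rOp q (lo i) (hi i) :=
  congrArg Units.val (repUnits_sigma hq i)

theorem rep_t (j : Fin n) : rep D N hq n (Framed.t j) = diag D N n (colourChar j) :=
  congrArg Units.val (repUnits_t hq j)

theorem sum_Icc_eq_sum_zmod {A : Type*} [AddCommMonoid A] (f : ZMod d → A) :
    ∑ s ∈ Finset.Icc 1 d, f (s : ZMod d) = ∑ s : ZMod d, f s := by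
  -- The range starts at `1`, so the residue `0` is represented by `d`.
  refine Finset.sum_nbij' (fun s : ℕ => (s : ZMod d)) (fun s => if s = 0 then d else s.val)
    (by simp) ?_ ?_ ?_ (by simp)
  · intro s _
    split_ifs with h
    · simp [NeZero.one_le]
    · rw [Finset.mem_Icc]
      exact ⟨Nat.one_le_iff_ne_zero.mpr (by simpa using h), (ZMod.val_lt s).le⟩
  · intro s hs
    rw [Finset.mem_Icc] at hs
    rcases hs.2.eq_or_lt with rfl | h
    · simp
    · have h0 : (s : ZMod d) ≠ 0 := by
        rw [Ne, ZMod.natCast_eq_zero_iff]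
        exact fun h' => (Nat.le_of_dvd hs.1 h').not_gt h
      simp [h0, ZMod.val_cast_of_lt h]
  · intro s _
    split_ifs with h <;> simp [h]

theorem rep_tt (i : Fin (n - 1)) (s : ℕ) (f : WordFn D N n) (w : Fin n → Letter D N) :
    rep D N hq n (Framed.tt i s) f w =
      ZMod.stdAddChar ((((w (lo i)).1 : ZMod d) - ((w (hi i)).1 : ZMod d)) * (s : ZMod d)) *
        f w := by
  -- The inverse power is written with exponent `(d - 1) * s`, and `d - 1` is `-1` modulo `d`.
  have h : rep D N hq n (Framed.tt i s) =
      diag D N n (colourChar (lo i) ^ s * colourChar (hi i) ^ ((d - 1) * s)) := by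
    rw [Framed.tt, ← inv_pow, Framed.t_inv, ← pow_mul, map_mul, map_pow, map_pow, rep_t, rep_t,
      map_mul, map_pow, map_pow]
  rw [h, diag_apply, Pi.mul_apply, colourChar_pow_apply, colourChar_pow_apply,
    ← AddChar.map_add_eq_mul, Nat.cast_mul, Nat.cast_sub NeZero.one_le]
  congr 3
  simp
  ring

/-- Orthogonality of characters: `e_i` acts as the projection to words with equal colours at the two
positions. -/
theorem rep_sum_tt (i : Fin (n - 1)) :
    (1 / (d : ℂ)) • ∑ s ∈ Finset.Icc 1 d, rep D N hq n (Framed.tt i s) =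
      diag D N n (sameColour (lo i) (hi i)) := by
  have hd : (d : ℂ) ≠ 0 := Nat.cast_ne_zero.mpr (NeZero.ne d)
  refine LinearMap.ext fun f => funext fun w => ?_
  simp only [LinearMap.smul_apply, LinearMap.sum_apply, Pi.smul_apply, Finset.sum_apply, rep_tt,
    diag_apply, smul_eq_mul, ← Finset.sum_mul, sameColour]
  rw [sum_Icc_eq_sum_zmod fun s => (ZMod.stdAddChar
    ((((w (lo i)).1 : ZMod d) - ((w (hi i)).1 : ZMod d)) * s) : ℂ), sum_char]
  simp only [sub_eq_zero, Subtype.coe_inj]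
  split_ifs
  · field_simp
  · simp

/-! ### The Markov trace on tensor space -/

/-- The weight of a word, the product of the weights `μ` of its letters. -/
def weight (μ : Letter D N → ℂ) (n : ℕ) : WordFn D N n := fun w => ∏ j, μ (w j)

/-- The restriction of a function to the words ending in `a`. -/
def restrict (a : Letter D N) : WordFn D N (n + 1) →ₗ[ℂ] WordFn D N n where
  toFun f w := f (Fin.snoc w a)
  map_add' _ _ := rfl
  map_smul' _ _ := rfl

/-- The weight of a word does not depend on the order of its letters. This makes the twisted trace
cyclic. -/
theorem commute_weight_rep (μ : Letter D N → ℂ) (x : Framed d n) :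
    Commute (diag D N n (weight μ n)) (rep D N hq n x) := by
  induction x using Framed.induction_on with
  | one => simp
  | sigma i =>
    rw [rep_sigma]
    refine commute_diag_rOp q _ _ fun w => ?_
    exact Equiv.prod_comp (Equiv.swap (lo i) (hi i)) fun j => μ (w j)
  | t j =>
    rw [rep_t, Commute, SemiconjBy, ← map_mul, ← map_mul, mul_comm]
  | mul a b ha hb => rw [map_mul]; exact ha.mul_right hb
  | inv a ha =>
    have : rep D N hq n a * rep D N hq n a⁻¹ = 1 := by rw [← map_mul, mul_inv_cancel, map_one]
    have h2 : rep D N hq n a⁻¹ * rep D N hq n a = 1 := by rw [← map_mul, inv_mul_cancel, map_one]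
    exact Commute.units_inv_right (u := ⟨_, _, this, h2⟩) ha

/-- Framed braids on the first `n` strands never touch the last letter. -/
theorem restrict_rep_succ (a : Letter D N) (x : Framed d n) :
    restrict a ∘ₗ rep D N hq (n + 1) (Framed.succ d n x) = rep D N hq n x ∘ₗ restrict a := by
  induction x using Framed.induction_on with
  | one => simp; rfl
  | sigma i =>
    rw [Framed.succ_sigma, rep_sigma, rep_sigma]
    refine LinearMap.ext fun f => funext fun w => ?_
    have h1 : (Fin.snoc w a : Fin (n + 1) → Letter D N) (lo (Framed.up i)) = w (lo i) :=
      snoc_castSucc_eq w a (lo i)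
    have h2 : (Fin.snoc w a : Fin (n + 1) → Letter D N) (hi (Framed.up i)) = w (hi i) :=
      snoc_castSucc_eq w a (hi i)
    have h3 : (Fin.snoc w a : Fin (n + 1) → Letter D N) ∘
        Equiv.swap (lo (Framed.up i)) (hi (Framed.up i)) =
        Fin.snoc (w ∘ Equiv.swap (lo i) (hi i)) a := by
      funext j
      induction j using Fin.lastCases with
      | last =>
        rw [Function.comp_apply, Equiv.swap_apply_of_ne_of_ne]
        · simp
        all_goals simp only [lo, hi, Framed.up, Fin.last, ne_eq, Fin.mk.injEq]; omega
      | cast j =>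
        rw [Function.comp_apply, ← Framed.castSucc_swap, snoc_castSucc_eq, snoc_castSucc_eq,
          Function.comp_apply]
    simp only [restrict, LinearMap.comp_apply, LinearMap.coe_mk, AddHom.coe_mk, rOp_apply, h1, h2,
      h3]
  | t j =>
    rw [Framed.succ_t, rep_t, rep_t]
    refine LinearMap.ext fun f => funext fun w => ?_
    simp only [restrict, LinearMap.comp_apply, LinearMap.coe_mk, AddHom.coe_mk, diag_apply,
      colourChar, snoc_castSucc_eq]
  | mul x y hx hy =>
    rw [map_mul, map_mul, map_mul, Module.End.mul_eq_comp, Module.End.mul_eq_comp,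
      ← LinearMap.comp_assoc, hx, LinearMap.comp_assoc, hy, LinearMap.comp_assoc]
  | inv x hx =>
    have h1 : rep D N hq n x⁻¹ ∘ₗ rep D N hq n x = LinearMap.id := by
      rw [← Module.End.mul_eq_comp, ← map_mul, inv_mul_cancel, map_one]; rfl
    have h2 : rep D N hq (n + 1) (Framed.succ d n x) ∘ₗ
        rep D N hq (n + 1) (Framed.succ d n x⁻¹) = LinearMap.id := by
      rw [← Module.End.mul_eq_comp, ← map_mul, ← map_mul, mul_inv_cancel, map_one, map_one]; rfl
    calc _ = (rep D N hq n x⁻¹ ∘ₗ rep D N hq n x) ∘ₗ restrict a ∘ₗ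
            rep D N hq (n + 1) (Framed.succ d n x⁻¹) := by rw [h1, LinearMap.id_comp]
      _ = rep D N hq n x⁻¹ ∘ₗ (restrict a ∘ₗ rep D N hq (n + 1) (Framed.succ d n x)) ∘ₗ
            rep D N hq (n + 1) (Framed.succ d n x⁻¹) := by rw [hx]; simp only [LinearMap.comp_assoc]
      _ = _ := by rw [LinearMap.comp_assoc, h2, LinearMap.comp_id]

theorem trace_eq_sum (A : Module.End ℂ (WordFn D N n)) :
    LinearMap.trace ℂ _ A = ∑ w, A (Pi.single w 1) w := by
  rw [LinearMap.trace_eq_matrix_trace ℂ (Pi.basisFun ℂ _), Matrix.trace]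
  simp

/-- A partial trace that is scalar on words can be carried out first. -/
theorem trace_succ_mul (μ : Letter D N → ℂ) (B : Module.End ℂ (WordFn D N (n + 1))) (c : ℂ)
    (hB : ∀ v w : Fin n → Letter D N,
      ∑ a, μ a * B (Pi.single (Fin.snoc v a) 1) (Fin.snoc w a) = if w = v then c else 0)
    (x : Framed d n) :
    LinearMap.trace ℂ _ (rep D N hq (n + 1) (Framed.succ d n x) * B *
        diag D N (n + 1) (weight μ (n + 1))) =
      c * LinearMap.trace ℂ _ (rep D N hq n x * diag D N n (weight μ n)) := by
  have hdiag : ∀ (m : ℕ) (w : Fin m → Letter D N),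
      diag D N m (weight μ m) (Pi.single w 1) = weight μ m w • Pi.single w 1 := by
    intro m w
    funext v
    rw [diag_apply, Pi.smul_apply, smul_eq_mul]
    by_cases h : v = w
    · rw [h]
    · simp [Pi.single_eq_of_ne h]
  have hw : ∀ (v : Fin n → Letter D N) a, weight μ (n + 1) (Fin.snoc v a) = weight μ n v * μ a := by
    intro v a
    simp [weight, Fin.prod_univ_castSucc]
  have hr : ∀ (f : WordFn D N (n + 1)) v a,
      rep D N hq (n + 1) (Framed.succ d n x) f (Fin.snoc v a) = rep D N hq n x (restrict a f) v :=
    fun f v a => congrFun (LinearMap.congr_fun (restrict_rep_succ hq a x) f) v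
  -- The hypothesis `hB` as an identity of functions on words, to which the linear operator of `x`
  -- can be applied.
  have hs : ∀ v : Fin n → Letter D N,
      ∑ a, μ a • restrict a (B (Pi.single (Fin.snoc v a) 1)) = c • Pi.single v 1 := by
    intro v
    funext w
    rw [Finset.sum_apply, Pi.smul_apply, Pi.single_apply, smul_eq_mul, mul_ite, mul_one, mul_zero]
    exact hB v w
  rw [trace_eq_sum, trace_eq_sum, Finset.mul_sum,
    ← (Fin.snocEquiv fun _ => Letter D N).sum_comp, Fintype.sum_prod_type_right]
  refine Finset.sum_congr rfl fun v _ => ?_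
  simp only [Fin.snocEquiv, Equiv.coe_fn_mk, Module.End.mul_apply, hdiag, map_smul, Pi.smul_apply,
    smul_eq_mul]
  have := congrArg (fun f => rep D N hq n x f v) (hs v)
  simp only [map_sum, map_smul, Finset.sum_apply, Pi.smul_apply, smul_eq_mul] at this
  rw [mul_left_comm, ← this, Finset.mul_sum]
  refine Finset.sum_congr rfl fun a _ => ?_
  rw [hw, hr]
  ring

/-- The Markov trace on tensor space. -/
def tensorTrace (D : Finset (ZMod d)) (N : ℕ) (n : ℕ) (x : Framed d n) : ℂ :=
  LinearMap.trace ℂ _ (rep D N hq n x * diag D N n (weight (letterWeight q) n))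

/-- The Markov and framing rules are partial traces over the last letter. The hypothesis `hN` keeps
the denominator in `letterWeight` nonzero. -/
theorem isMarkovFn_tensorTrace (hN : (q⁻¹ ^ 2) ^ N ≠ 1) :
    IsMarkovFn d (XD D) (q - q⁻¹) (zParam D N q) (tensorTrace hq D N) where
  one := by
    rw [tensorTrace, trace_eq_sum]
    simp [diag_apply, weight]
  trace n a b := by
    rw [tensorTrace, tensorTrace, map_mul (rep D N hq n), map_mul (rep D N hq n), mul_assoc,
      ← (commute_weight_rep hq _ b).eq, ← mul_assoc, LinearMap.trace_mul_comm, mul_assoc]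
  markov n a := by
    rw [tensorTrace, map_mul (rep D N hq _), rep_sigma]
    exact trace_succ_mul hq _ _ _ (partial_trace_rOp _ _ (letterWeight_rel hq)) a
  framing n a s := by
    rw [tensorTrace, map_mul (rep D N hq _), map_pow, rep_t, ← map_pow]
    refine trace_succ_mul hq _ _ _ (partial_trace_diag _ _ _ fun w => ?_) a
    simp only [colourChar_pow_apply, Fin.snoc_last]
    rw [sum_letterWeight_mul hN fun c : D =>
        (ZMod.stdAddChar ((c : ZMod d) * (s : ZMod d)) : ℂ), XD,
      Finset.sum_coe_sort D fun c => (ZMod.stdAddChar (c * (s : ZMod d)) : ℂ)]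
  quad n i a b := by
    have h := rOp_sq (D := D) (N := N) hq (lo i) (hi i)
    rw [← rep_sum_tt hq, ← rep_sigma hq] at h
    have h2 : rep D N hq n (a * Framed.sigma i ^ 2 * b) = rep D N hq n (a * b) +
        ((q - q⁻¹) / d) • ∑ s ∈ Finset.Icc 1 d,
          rep D N hq n (a * Framed.tt i s * Framed.sigma i * b) := by
      simp only [map_mul, map_pow]
      rw [pow_two, h]
      simp only [mul_add, add_mul, mul_one, smul_mul_assoc, mul_smul_comm, Finset.sum_mul,
        Finset.mul_sum, smul_smul, mul_assoc, mul_one_div]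
    simp only [tensorTrace]
    rw [h2, add_mul, map_add, smul_mul_assoc, map_smul, Finset.sum_mul, map_sum, smul_eq_mul]

/-- Once the letter before it is fixed, the last letter must have the same colour, and the letters
of one colour have total weight `1 / |D| = E_D`. -/
theorem tensorTrace_idem (hD : D.Nonempty) (hN : (q⁻¹ ^ 2) ^ N ≠ 1) (a : Framed d (n + 1)) :
    1 / (d : ℂ) * ∑ s ∈ Finset.Icc 1 d, tensorTrace hq D N (n + 2)
        (Framed.succ d (n + 1) a * Framed.tt ⟨n, by omega⟩ s) =
      ED D * tensorTrace hq D N (n + 1) a := by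
  have h : 1 / (d : ℂ) * ∑ s ∈ Finset.Icc 1 d, tensorTrace hq D N (n + 2)
        (Framed.succ d (n + 1) a * Framed.tt ⟨n, by omega⟩ s) =
      LinearMap.trace ℂ _ (rep D N hq (n + 2) (Framed.succ d (n + 1) a) *
        diag D N (n + 2) (sameColour (lo ⟨n, by omega⟩) (hi ⟨n, by omega⟩)) *
        diag D N (n + 2) (weight (letterWeight q) (n + 2))) := by
    rw [← rep_sum_tt hq]
    simp only [tensorTrace, map_mul, Finset.sum_mul, Finset.mul_sum, map_sum, smul_mul_assoc,
      mul_smul_comm, map_smul, smul_eq_mul]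
  rw [h]
  refine trace_succ_mul hq _ _ _ (partial_trace_diag _ _ _ fun w => ?_) a
  have hlo : ∀ b, (Fin.snoc w b : Fin (n + 2) → Letter D N) (lo ⟨n, by omega⟩) = w (Fin.last n) :=
    fun b => snoc_castSucc_eq w b (Fin.last n)
  have hhi : ∀ b, (Fin.snoc w b : Fin (n + 2) → Letter D N) (hi ⟨n, by omega⟩) = b :=
    fun b => Fin.snoc_last ..
  simp only [sameColour, hlo, hhi]
  rw [sum_letterWeight_mul hN fun c => if (w (Fin.last n)).1 = c then 1 else 0, ED_eq D hD]
  simp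

end RMatrix

end

end YokonumaHecke

namespace YokonumaHecke

noncomputable section

/-! ### The universal Markov function -/

section Universal

variable {d : ℕ} {D : Finset (ZMod d)} {n : ℕ}

/-! ### Density of the parameters -/

theorem natCast_add_two_ne_zero (m : ℕ) : ((m + 2 : ℕ) : ℂ) ≠ 0 :=
  Nat.cast_ne_zero.mpr (by omega)

theorem inv_sq_pow (m N : ℕ) :
    ((((m + 2 : ℕ) : ℂ)⁻¹) ^ 2) ^ N = (((m + 2) ^ (2 * N) : ℕ) : ℂ)⁻¹ := by
  rw [← pow_mul, inv_pow, Nat.cast_pow]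

theorem inv_sq_pow_ne_one (m N : ℕ) : ((((m + 2 : ℕ) : ℂ)⁻¹) ^ 2) ^ (N + 1) ≠ 1 := by
  rw [inv_sq_pow, Ne, inv_eq_one, Nat.cast_eq_one, Nat.pow_eq_one]
  omega

/-- For fixed `q = m + 2`, the value of `z` determines `q ^ (2 * (N + 1))`, and the powers of an
integer at least `2` are distinct. -/
theorem zParam_injective (hD : D.Nonempty) (m : ℕ) :
    Function.Injective fun N => zParam D (N + 1) ((m + 2 : ℕ) : ℂ) := by
  intro N N' h
  have hc : (D.card : ℂ) ≠ 0 := Nat.cast_ne_zero.mpr hD.card_pos.ne'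
  have h1 : 1 - (((m + 2 : ℕ) : ℂ)⁻¹) ^ 2 ≠ 0 := by
    simpa using sub_ne_zero.mpr (inv_sq_pow_ne_one m 0).symm
  have h2 := sub_ne_zero.mpr (inv_sq_pow_ne_one m N).symm
  have h3 := sub_ne_zero.mpr (inv_sq_pow_ne_one m N').symm
  simp only [zParam] at h
  have h4 := mul_left_cancel₀ (one_div_ne_zero hc)
    (mul_left_cancel₀ (natCast_add_two_ne_zero m) h)
  rw [div_eq_div_iff h2 h3] at h4
  have h5 := sub_right_injective (mul_left_cancel₀ h1 h4)
  simp only [inv_sq_pow, inv_inj, Nat.cast_inj] at h5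
  have := Nat.pow_right_injective (le_add_self : 2 ≤ m + 2) h5
  omega

theorem sub_inv_injective :
    Function.Injective fun m : ℕ => ((m + 2 : ℕ) : ℂ) - ((m + 2 : ℕ) : ℂ)⁻¹ := by
  intro m m' h
  have h1 := natCast_add_two_ne_zero m
  have h2 := natCast_add_two_ne_zero m'
  simp only at h
  generalize hk : m + 2 = k at h h1
  generalize hl : m' + 2 = l at h h2
  -- Clearing denominators in `k - 1/k = l - 1/l` gives this product, whose second factor is a
  -- positive integer.
  have h3 : ((k : ℂ) - l) * ((k * l + 1 : ℕ) : ℂ) = 0 := by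
    push_cast
    field_simp at h
    linear_combination h
  rcases mul_eq_zero.mp h3 with h4 | h4
  · have : k = l := by exact_mod_cast sub_eq_zero.mp h4
    omega
  · exact absurd h4 (Nat.cast_ne_zero.mpr (Nat.succ_ne_zero _))

/-- The parameters of the Markov traces on tensor space are Zariski dense. -/
theorem eq_of_evalEval_eq (hD : D.Nonempty) {p p' : ℂ[X][X]}
    (h : ∀ m N : ℕ, p.evalEval (((m + 2 : ℕ) : ℂ) - ((m + 2 : ℕ) : ℂ)⁻¹)
        (zParam D (N + 1) ((m + 2 : ℕ) : ℂ)) =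
      p'.evalEval (((m + 2 : ℕ) : ℂ) - ((m + 2 : ℕ) : ℂ)⁻¹)
        (zParam D (N + 1) ((m + 2 : ℕ) : ℂ))) : p = p' := by
  -- For each fixed `h` there are infinitely many values of `z`; afterwards each coefficient is
  -- compared at infinitely many values of `h`.
  have h1 : ∀ m : ℕ, p.map (evalRingHom (((m + 2 : ℕ) : ℂ) - ((m + 2 : ℕ) : ℂ)⁻¹)) =
      p'.map (evalRingHom (((m + 2 : ℕ) : ℂ) - ((m + 2 : ℕ) : ℂ)⁻¹)) := by
    intro m
    refine eq_of_infinite_eval_eq _ _ (Set.infinite_of_injective_forall_mem (zParam_injective hD m)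
      fun N => ?_)
    simpa only [Set.mem_ofPred_eq, map_evalRingHom_eval] using h m N
  ext1 k
  refine eq_of_infinite_eval_eq _ _ (Set.infinite_of_injective_forall_mem sub_inv_injective
    fun m => ?_)
  simpa using congrArg (fun f => coeff f k) (h1 m)

variable [NeZero d]

/-- The value of the Markov functions with framing parameters `X_D` at a framed braid, as a
polynomial in `z` with coefficients in `ℂ[h]`, where `h = q - q⁻¹`. -/
def univ (D : Finset (ZMod d)) (x : Framed d n) : ℂ[X][X] := (exists_poly (XD D) x).choose

theorem IsMarkovFn.eq_univ {h z : ℂ} {φ : ∀ n, Framed d n → ℂ} (hφ : IsMarkovFn d (XD D) h z φ)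
    (x : Framed d n) : φ n x = (univ D x).evalEval h z :=
  (exists_poly (XD D) x).choose_spec h z φ hφ

theorem evalEval_univ (m N : ℕ) (x : Framed d n) :
    (univ D x).evalEval (((m + 2 : ℕ) : ℂ) - ((m + 2 : ℕ) : ℂ)⁻¹)
        (zParam D (N + 1) ((m + 2 : ℕ) : ℂ)) =
      tensorTrace (natCast_add_two_ne_zero m) D (N + 1) n x :=
  ((isMarkovFn_tensorTrace _ (inv_sq_pow_ne_one m N)).eq_univ x).symm

/-- Each rule is a polynomial identity in `h` and `z` that holds at the dense set of tensor traces,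
hence at every pair of complex numbers. -/
theorem isMarkovFn_univ (hD : D.Nonempty) (h z : ℂ) :
    IsMarkovFn d (XD D) h z fun _ x => (univ D x).evalEval h z where
  one := by
    have : univ D (1 : Framed d 0) = 1 := eq_of_evalEval_eq hD fun m N => by
      rw [evalEval_univ, evalEval_one]
      exact (isMarkovFn_tensorTrace _ (inv_sq_pow_ne_one m N)).one
    rw [this, evalEval_one]
  trace n a b := by
    have : univ D (a * b) = univ D (b * a) := eq_of_evalEval_eq hD fun m N => by
      rw [evalEval_univ, evalEval_univ]
      exact (isMarkovFn_tensorTrace _ (inv_sq_pow_ne_one m N)).trace n a b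
    simp only [this]
  markov n a := by
    have : univ D (Framed.succ d (n + 1) a * Framed.sigma ⟨n, by omega⟩) = X * univ D a :=
      eq_of_evalEval_eq hD fun m N => by
        rw [evalEval_mul, evalEval_X, evalEval_univ, evalEval_univ]
        exact (isMarkovFn_tensorTrace _ (inv_sq_pow_ne_one m N)).markov n a
    rw [this, evalEval_mul, evalEval_X]
  framing n a s := by
    have : univ D (Framed.succ d n a * Framed.t (Fin.last n) ^ s) = C (C (XD D s)) * univ D a :=
      eq_of_evalEval_eq hD fun m N => by
        rw [evalEval_mul, evalEval_C, eval_C, evalEval_univ, evalEval_univ]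
        exact (isMarkovFn_tensorTrace _ (inv_sq_pow_ne_one m N)).framing n a s
    rw [this, evalEval_mul, evalEval_C, eval_C]
  quad n i a b := by
    have : univ D (a * Framed.sigma i ^ 2 * b) = univ D (a * b) + C (X * C (1 / (d : ℂ))) *
        ∑ s ∈ Finset.Icc 1 d, univ D (a * Framed.tt i s * Framed.sigma i * b) :=
      eq_of_evalEval_eq hD fun m N => by
        simp only [evalEval_add, evalEval_mul, evalEval_C, eval_C, eval_mul, eval_X,
          evalEval_finsetSum, evalEval_univ, mul_one_div]
        exact (isMarkovFn_tensorTrace _ (inv_sq_pow_ne_one m N)).quad n i a b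
    simp only [this, evalEval_add, evalEval_mul, evalEval_C, eval_C, eval_mul, eval_X,
      evalEval_finsetSum, mul_one_div]

theorem univ_idem (hD : D.Nonempty) (h z : ℂ) (a : Framed d (n + 1)) :
    1 / (d : ℂ) * ∑ s ∈ Finset.Icc 1 d, (univ D
        (Framed.succ d (n + 1) a * Framed.tt ⟨n, by omega⟩ s)).evalEval h z =
      ED D * (univ D a).evalEval h z := by
  have : C (C (1 / (d : ℂ))) * ∑ s ∈ Finset.Icc 1 d, univ D
        (Framed.succ d (n + 1) a * Framed.tt ⟨n, by omega⟩ s) = C (C (ED D)) * univ D a :=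
    eq_of_evalEval_eq hD fun m N => by
      simp only [evalEval_mul, evalEval_C, eval_C, evalEval_finsetSum, evalEval_univ]
      exact tensorTrace_idem _ hD (inv_sq_pow_ne_one m N) a
  simpa only [evalEval_mul, evalEval_C, eval_C, evalEval_finsetSum] using
    congrArg (evalEval h z) this

theorem IsMarkovFn.succ {h z : ℂ} {φ : ∀ n, Framed d n → ℂ} (hD : D.Nonempty)
    (hφ : IsMarkovFn d (XD D) h z φ) (x : Framed d n) : φ (n + 1) (Framed.succ d n x) = φ n x := by
  simpa [XD_zero D hD] using hφ.framing n x 0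

theorem IsMarkovFn.apply_one {h z : ℂ} {φ : ∀ n, Framed d n → ℂ} (hD : D.Nonempty)
    (hφ : IsMarkovFn d (XD D) h z φ) (n : ℕ) : φ n 1 = 1 := by
  induction n with
  | zero => exact hφ.one
  | succ n ih => rw [← map_one (Framed.succ d n), hφ.succ hD, ih]

theorem sum_univ_tt (hD : D.Nonempty) (h z : ℂ) (i : Fin (n - 1)) :
    1 / (d : ℂ) * ∑ s ∈ Finset.Icc 1 d, (univ D (Framed.tt i s)).evalEval h z = ED D := by
  have hφ := isMarkovFn_univ hD h z
  induction n with
  | zero => exact i.elim0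
  | succ n ih =>
    obtain ⟨j, rfl⟩ | hi := Framed.sigma_cases i
    · rw [← ih j]
      simp only [← Framed.succ_tt, hφ.succ hD]
    · obtain ⟨m, rfl⟩ : ∃ m, n = m + 1 := ⟨i, hi.symm⟩
      obtain rfl := Framed.eq_last i hi
      have := univ_idem hD h z (1 : Framed d (m + 1))
      rw [hφ.apply_one hD, mul_one] at this
      simpa only [map_one, one_mul] using this

end Universal

/-! ### Mirror images of framed braids -/

namespace Framed

variable {d n : ℕ}

/-- The endomorphism of `F_{d,n}` with `σ_i ↦ σ_i⁻¹` and `t_j ↦ t_j`. -/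
def mirror (d n : ℕ) : Framed d n →* Framed d n :=
  PresentedGroup.toGroup
    (f := fun x => match x with
      | FramedGen.sigma i => (sigma i)⁻¹
      | FramedGen.t j => t j) (by
    rintro r (⟨i, j, h⟩ | ⟨i, j, h⟩ | ⟨i, j⟩ | ⟨i, j⟩ | ⟨j⟩)
    · have := congrArg (·⁻¹) (sigma_braid (d := d) i j h)
      simp only [map_mul, map_inv, FreeGroup.lift_apply_of, mul_inv_eq_one]
      simpa [mul_assoc] using this
    · have := congrArg (·⁻¹) (sigma_comm (d := d) i j h)
      simp only [map_mul, map_inv, FreeGroup.lift_apply_of, mul_inv_eq_one]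
      simpa using this.symm
    · simpa only [map_mul, map_inv, FreeGroup.lift_apply_of, mul_inv_eq_one] using t_comm i j
    · simp only [map_mul, map_inv, FreeGroup.lift_apply_of, mul_inv_eq_one]
      have := t_sigma (d := d) i (Equiv.swap (lo i) (hi i) j)
      rw [Equiv.swap_apply_self] at this
      rw [mul_inv_eq_iff_eq_mul, mul_assoc, this, inv_mul_cancel_left]
    · simpa only [map_pow, FreeGroup.lift_apply_of] using t_pow j)

theorem mirror_sigma (i : Fin (n - 1)) : mirror d n (sigma i) = (sigma i)⁻¹ :=
  PresentedGroup.toGroup.of _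

theorem mirror_t (j : Fin n) : mirror d n (t j) = t j := PresentedGroup.toGroup.of _

theorem mirror_tt (i : Fin (n - 1)) (s : ℕ) : mirror d n (tt i s) = tt i s := by
  simp only [tt, map_mul, map_inv, map_pow, mirror_t]

theorem mirror_succ (x : Framed d n) :
    mirror d (n + 1) (succ d n x) = succ d n (mirror d n x) := by
  induction x using induction_on with
  | one => simp
  | sigma i => rw [succ_sigma, mirror_sigma, mirror_sigma, map_inv, succ_sigma]
  | t j => rw [succ_t, mirror_t, mirror_t, succ_t]
  | mul a b ha hb => simp only [map_mul, ha, hb]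
  | inv a ha => simp only [map_inv, ha]

theorem ofBraid_mirror (α : Braid n) :
    ofBraid d n (Braid.mirror n α) = mirror d n (ofBraid d n α) := by
  have h : ∀ i : Fin (n - 1), ofBraid d n (Braid.sigma i) = sigma i := fun i =>
    PresentedGroup.toGroup.of _
  have h' : ∀ i : Fin (n - 1), Braid.mirror n (Braid.sigma i) = (Braid.sigma i)⁻¹ := fun i =>
    PresentedGroup.toGroup.of _
  suffices H : (ofBraid d n).comp (Braid.mirror n) = (mirror d n).comp (ofBraid d n) from
    DFunLike.congr_fun H α
  refine PresentedGroup.ext fun i => ?_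
  change ofBraid d n (Braid.mirror n (Braid.sigma i)) = mirror d n (ofBraid d n (Braid.sigma i))
  rw [h, h', map_inv, h, mirror_sigma]

end Framed

/-- Since `σ⁻¹ = σ - h e`, the Markov rule for `σ⁻¹` has parameter `z - h E`, where `hE` evaluates
the `e`-term. Multiplying by `σ⁻¹` gives `σ⁻² = 1 - h e σ⁻¹`, the quadratic relation with `-h`. -/
theorem IsMarkovFn.comp_mirror {d : ℕ} {x : ZMod d → ℂ} {h z E : ℂ} {φ : ∀ n, Framed d n → ℂ}
    (hφ : IsMarkovFn d x h z φ)
    (hE : ∀ n (a : Framed d (n + 1)), 1 / (d : ℂ) * ∑ s ∈ Finset.Icc 1 d,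
      φ (n + 2) (Framed.succ d (n + 1) a * Framed.tt ⟨n, by omega⟩ s) = E * φ (n + 1) a) :
    IsMarkovFn d x (-h) (z - h * E) fun n a => φ n (Framed.mirror d n a) where
  one := by simpa using hφ.one
  trace n a b := by rw [map_mul, map_mul, hφ.trace]
  markov n a := by
    have := (hφ.quad (n + 2)).apply_inv ⟨n, by omega⟩
      (Framed.succ d (n + 1) (Framed.mirror d (n + 1) a)) 1
    simp only [mul_one] at this
    rw [map_mul, Framed.mirror_sigma, Framed.mirror_succ, this, hφ.markov]
    linear_combination (-h) * hE n (Framed.mirror d (n + 1) a)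
  framing n a s := by
    rw [map_mul, Framed.mirror_succ, map_pow, Framed.mirror_t, hφ.framing]
  quad n i a b := by
    simp only [map_mul, map_pow, Framed.mirror_sigma, Framed.mirror_tt]
    have := (hφ.quad n).apply_inv i (Framed.mirror d n a)
      ((Framed.sigma i)⁻¹ * Framed.mirror d n b)
    rw [pow_two]
    simp only [mul_assoc, mul_inv_cancel_left] at this ⊢
    rw [this]
    ring

/-- The mirrored function is a Markov function for the changed parameters, and Markov functions are
determined by their parameters. -/
theorem univ_mirror {d : ℕ} [NeZero d] {D : Finset (ZMod d)} (hD : D.Nonempty) (h z : ℂ) {n : ℕ}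
    (x : Framed d n) : (univ D (Framed.mirror d n x)).evalEval h z =
      (univ D x).evalEval (-h) (z - h * ED D) :=
  ((isMarkovFn_univ hD h z).comp_mirror fun _ a => univ_idem hD h z a).eq_univ x

/-! ### The Yokonuma-Hecke algebra -/

namespace Y

variable {d : ℕ} {q : ℂ} {n : ℕ}

theorem induction_on {p : Y d q n → Prop} (a : Y d q n) (of : ∀ x, p (ofFramed d q n x))
    (add : ∀ a b, p a → p b → p (a + b)) (smul : ∀ (c : ℂ) a, p a → p (c • a)) : p a := by
  obtain ⟨b, rfl⟩ := RingQuot.mkAlgHom_surjective ℂ (QuadRel d q n) a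
  induction b using MonoidAlgebra.induction_on with
  | of x => exact of x
  | add a b ha hb => rw [map_add]; exact add _ _ ha hb
  | smul c a ha => rw [map_smul]; exact smul _ _ ha

theorem incl_ofFramed (x : Framed d n) :
    incl d q n (ofFramed d q n x) = ofFramed d q (n + 1) (Framed.succ d n x) := by
  simp only [incl, ofFramed, proj, MonoidHom.comp_apply, MonoidHom.coe_coe,
    RingQuot.liftAlgHom_mkAlgHom_apply]
  simp [grp]

theorem e_eq (i : Fin (n - 1)) :
    (e i : Y d q n) = (1 / (d : ℂ)) • ∑ s ∈ Finset.Icc 1 d, ofFramed d q n (Framed.tt i s) := by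
  simp only [e, idem, map_smul, map_sum]
  rfl

theorem ofFramed_quad (i : Fin (n - 1)) (a b : Framed d n) :
    ofFramed d q n (a * Framed.sigma i ^ 2 * b) = ofFramed d q n (a * b) +
      ((q - q⁻¹) / d) • ∑ s ∈ Finset.Icc 1 d,
        ofFramed d q n (a * Framed.tt i s * Framed.sigma i * b) := by
  have h : proj d q n _ = proj d q n _ :=
    RingQuot.mkAlgHom_rel ℂ (QuadRel.quad (d := d) (q := q) i)
  have h' : ofFramed d q n (Framed.sigma i) ^ 2 =
      1 + (q - q⁻¹) • (e i * ofFramed d q n (Framed.sigma i)) := by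
    simp only [map_add, map_mul, map_pow, map_smul, map_one] at h
    exact h
  simp only [map_mul, map_pow, h', e_eq]
  simp only [mul_add, add_mul, mul_one, smul_mul_assoc, mul_smul_comm, Finset.sum_mul,
    Finset.mul_sum, smul_smul, mul_assoc, mul_one_div]

/-- Functions on `F_{d,n}` that respect the quadratic relations extend to linear maps on
`Y_{d,n}(q)`. -/
theorem exists_linearMap {M : Type*} [CommRing M] [Algebra ℂ M] {ψ : Framed d n → M}
    (hψ : IsQuad (algebraMap ℂ M ((q - q⁻¹) / d)) ψ) :
    ∃ T : Y d q n →ₗ[ℂ] M, ∀ x, T (ofFramed d q n x) = ψ x := by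
  let Φ : MonoidAlgebra ℂ (Framed d n) →ₗ[ℂ] M :=
    Finsupp.linearCombination ℂ ψ ∘ₗ (MonoidAlgebra.coeffLinearEquiv ℂ).toLinearMap
  have hΦ : ∀ x, Φ (grp x) = ψ x := fun x => by simp [Φ, grp]
  -- The largest ring congruence on which `Φ` is constant. As `Φ` is only linear, it descends by way
  -- of the algebra homomorphism to the quotient by `J`.
  let J : RingCon (MonoidAlgebra ℂ (Framed d n)) :=
    { r := fun a b => ∀ x y, Φ (x * a * y) = Φ (x * b * y)
      iseqv := ⟨fun _ _ _ => rfl, fun h x y => (h x y).symm,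
        fun h h' x y => (h x y).trans (h' x y)⟩
      mul' := fun {a b a' b'} h h' x y => by
        rw [← mul_assoc, mul_assoc (x * a), h, ← mul_assoc, h', mul_assoc x]
      add' := fun {a b a' b'} h h' x y => by
        simp only [mul_add, add_mul, map_add, h x y, h' x y] }
  have hJ : ∀ a b, QuadRel d q n a b → J a b := by
    rintro _ _ ⟨i⟩ x y
    induction x using MonoidAlgebra.induction_on with
    | add a b ha hb => simp only [add_mul a b, add_mul _ _ y, map_add, ha, hb]
    | smul c a ha => simp only [smul_mul_assoc, map_smul] at ha ⊢; rw [ha]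
    | of x =>
      induction y using MonoidAlgebra.induction_on with
      | add a b ha hb => simp only [mul_add _ a b, map_add, ha, hb]
      | smul c a ha => simp only [mul_smul_comm, map_smul, ha]
      | of y =>
        have h1 := hψ i x y
        have h2 : grp x * (1 + (q - q⁻¹) • (idem d i * grp (Framed.sigma i))) * grp y =
            grp (x * y) + ((q - q⁻¹) / d) • ∑ s ∈ Finset.Icc 1 d,
              grp (x * Framed.tt i s * Framed.sigma i * y) := by
          simp only [idem, ← Framed.tt.eq_1, map_mul]
          simp only [mul_add, add_mul, mul_one, smul_mul_assoc, mul_smul_comm, Finset.sum_mul,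
            Finset.mul_sum, smul_smul, mul_assoc, mul_one_div]
        change Φ (grp x * _ * grp y) = Φ (grp x * _ * grp y)
        rw [h2, ← map_pow, ← map_mul, ← map_mul, hΦ, h1, map_add, map_smul, map_sum, hΦ,
          Algebra.smul_def]
        simp only [hΦ]
  have hker : ∀ a b, proj d q n a = proj d q n b → Φ a = Φ b := by
    intro a b hab
    have h1 : ∀ c, RingQuot.liftAlgHom ℂ ⟨RingCon.mkₐ ℂ J, fun a b h =>
        (RingCon.eq J).mpr (hJ a b h)⟩ (proj d q n c) = RingCon.mkₐ ℂ J c := fun c =>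
      RingQuot.liftAlgHom_mkAlgHom_apply ..
    have h2 : RingCon.mkₐ ℂ J a = RingCon.mkₐ ℂ J b := by rw [← h1, ← h1, hab]
    simpa using (RingCon.eq J).mp h2 1 1
  have hs := RingQuot.mkAlgHom_surjective ℂ (QuadRel d q n)
  have hs' : ∀ a, proj d q n (Function.surjInv hs a) = a := Function.surjInv_eq hs
  -- Any section of the projection will do: by `hker` the value does not depend on the chosen
  -- preimage.
  refine ⟨{ toFun := fun a => Φ (Function.surjInv hs a), map_add' := fun a b => ?_,
            map_smul' := fun c a => ?_ }, fun x => ?_⟩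
  · rw [← map_add]
    exact hker _ _ (by simp only [map_add, hs'])
  · rw [RingHom.id_apply, ← map_smul]
    exact hker _ _ (by simp only [map_smul, hs'])
  · rw [← hΦ]
    exact hker _ _ (hs' _)

end Y

/-! ### The Markov trace -/

section Trace

variable {d : ℕ} [NeZero d] {D : Finset (ZMod d)} {q : ℂ}

theorem IsMarkovTrace.isMarkovFn (hD : D.Nonempty) {T : ∀ n : ℕ, Y d q n →ₗ[ℂ] ℂ[X]}
    (hT : IsMarkovTrace d q (XD D) T) (z : ℂ) :
    IsMarkovFn d (XD D) (q - q⁻¹) z fun n x => (T n (Y.ofFramed d q n x)).eval z where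
  one := by rw [map_one, hT.one, eval_one]
  trace n a b := by
    rw [map_mul (Y.ofFramed d q n), map_mul (Y.ofFramed d q n), hT.trace]
  markov n a := by
    have := hT.markov n (Y.ofFramed d q (n + 1) a)
    rw [Y.incl_ofFramed, Y.g, ← map_mul (Y.ofFramed d q _)] at this
    rw [this, eval_mul, eval_X]
  framing n a s := by
    -- The trace rule covers only `1 ≤ s ≤ d - 1`. Other exponents are reduced modulo `d`, and the
    -- residue `0` is compatibility together with `x_0 = 1`.
    have ht : (Framed.t (Fin.last n) : Framed d (n + 1)) ^ s = Framed.t (Fin.last n) ^ (s % d) :=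
      pow_eq_pow_mod s (Framed.t_pow _)
    rw [ht, map_mul (Y.ofFramed d q _), map_pow, ← Y.incl_ofFramed, ← ZMod.natCast_mod s d]
    rcases Nat.eq_zero_or_pos (s % d) with h0 | h0
    · rw [h0, pow_zero, mul_one, hT.compat, Nat.cast_zero, XD_zero D hD, one_mul]
    · have := hT.framing n (Y.ofFramed d q n a) (s % d) h0
        (Nat.le_sub_one_of_lt (Nat.mod_lt s (NeZero.pos d)))
      rw [Y.t] at this
      rw [this, eval_mul, eval_C]
  quad n i a b := by
    dsimp only
    rw [Y.ofFramed_quad, map_add, map_smul, map_sum, eval_add, eval_smul, eval_finsetSum,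
      smul_eq_mul]

/-- This yields uniqueness, since the images of framed braids span the algebra. -/
theorem IsMarkovTrace.apply_ofFramed (hD : D.Nonempty) {T : ∀ n : ℕ, Y d q n →ₗ[ℂ] ℂ[X]}
    (hT : IsMarkovTrace d q (XD D) T) {n : ℕ} (x : Framed d n) :
    T n (Y.ofFramed d q n x) = (univ D x).map (evalRingHom (q - q⁻¹)) :=
  Polynomial.funext fun z => by
    rw [map_evalRingHom_eval]
    exact (hT.isMarkovFn hD z).eq_univ x

theorem isQuad_univ (hD : D.Nonempty) (n : ℕ) :
    IsQuad (algebraMap ℂ ℂ[X] ((q - q⁻¹) / d))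
      fun x : Framed d n => (univ D x).map (evalRingHom (q - q⁻¹)) := fun i a b =>
  Polynomial.funext fun z => by
    simpa only [eval_add, eval_mul, eval_finsetSum, map_evalRingHom_eval, algebraMap_eq, eval_C]
      using (isMarkovFn_univ hD (q - q⁻¹) z).quad n i a b

/-- The linear maps are built for each `n` separately; by linearity, compatibility and the rules
need checking only on framed braids, and there at each complex `z`. -/
theorem exists_isMarkovTrace (hD : D.Nonempty) (q : ℂ) :
    ∃ T : ∀ n : ℕ, Y d q n →ₗ[ℂ] ℂ[X], IsMarkovTrace d q (XD D) T := by
  choose T hT using fun n => Y.exists_linearMap (q := q) (isQuad_univ (D := D) hD n)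
  have hφ := isMarkovFn_univ hD (q - q⁻¹)
  refine ⟨T, fun n a => ?_, fun n a b => ?_, fun n => ?_, fun n a => ?_, fun n a s _ _ => ?_⟩
  · induction a using Y.induction_on with
    | of x =>
      rw [Y.incl_ofFramed, hT, hT]
      exact Polynomial.funext fun z => by
        simpa only [map_evalRingHom_eval] using (hφ z).succ hD x
    | add a b ha hb => simp only [map_add, ha, hb]
    | smul c a ha => simp only [map_smul, ha]
  · induction a using Y.induction_on with
    | of x =>
      induction b using Y.induction_on with
      | of y =>
        rw [← map_mul, ← map_mul, hT, hT]
        exact Polynomial.funext fun z => by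
          simpa only [map_evalRingHom_eval] using (hφ z).trace n x y
      | add a b ha hb => simp only [mul_add, add_mul, map_add, ha, hb]
      | smul c a ha => simp only [mul_smul_comm, smul_mul_assoc, map_smul, ha]
    | add a b ha hb => simp only [mul_add, add_mul, map_add, ha, hb]
    | smul c a ha => simp only [mul_smul_comm, smul_mul_assoc, map_smul, ha]
  · rw [← map_one (Y.ofFramed d q n), hT]
    exact Polynomial.funext fun z => by
      simpa only [map_evalRingHom_eval, eval_one] using (hφ z).apply_one hD n
  · induction a using Y.induction_on with
    | of x =>
      rw [Y.incl_ofFramed, Y.g, ← map_mul, hT, hT]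
      exact Polynomial.funext fun z => by
        simpa only [map_evalRingHom_eval, eval_mul, eval_X] using (hφ z).markov n x
    | add a b ha hb => simp only [map_add, mul_add, add_mul, ha, hb]
    | smul c a ha => simp only [map_smul, mul_smul_comm, smul_mul_assoc, ha]
  · induction a using Y.induction_on with
    | of x =>
      rw [Y.incl_ofFramed, Y.t, ← map_pow, ← map_mul, hT, hT]
      exact Polynomial.funext fun z => by
        simpa only [map_evalRingHom_eval, eval_mul, eval_C] using (hφ z).framing n x s
    | add a b ha hb => simp only [map_add, mul_add, add_mul, ha, hb]
    | smul c a ha => simp only [map_smul, mul_smul_comm, smul_mul_assoc, ha]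

theorem IsMarkovTrace.unique (hD : D.Nonempty) {T T' : ∀ n : ℕ, Y d q n →ₗ[ℂ] ℂ[X]}
    (hT : IsMarkovTrace d q (XD D) T) (hT' : IsMarkovTrace d q (XD D) T') : T = T' := by
  funext n
  ext1 a
  induction a using Y.induction_on with
  | of x => rw [hT.apply_ofFramed hD, hT'.apply_ofFramed hD]
  | add a b ha hb => simp only [map_add, ha, hb]
  | smul c a ha => simp only [map_smul, ha]

theorem isMarkovTrace_tr (hD : D.Nonempty) (q : ℂ) : IsMarkovTrace d q (XD D) (tr D q) :=
  Classical.epsilon_spec (exists_isMarkovTrace hD q)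

theorem tr_e (hD : D.Nonempty) {n : ℕ} (i : Fin (n - 1)) : tr D q n (Y.e i) = C (ED D) := by
  refine Polynomial.funext fun z => ?_
  rw [Y.e_eq, map_smul, map_sum, eval_smul, eval_finsetSum, eval_C, smul_eq_mul,
    ← sum_univ_tt hD (q - q⁻¹) z i]
  simp only [(isMarkovTrace_tr hD q).apply_ofFramed hD, map_evalRingHom_eval]

theorem brTr_mirror (hD : D.Nonempty) (q : ℂ) {n : ℕ} (α : Braid n) :
    brTr D q (Braid.mirror n α) = (brTr D q⁻¹ α).comp (X - C ((q - q⁻¹) * ED D)) := by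
  refine Polynomial.funext fun z => ?_
  rw [eval_comp, eval_sub, eval_X, eval_C, brTr, brTr, Y.ofBraid, Y.ofBraid, MonoidHom.comp_apply,
    MonoidHom.comp_apply, Framed.ofBraid_mirror, (isMarkovTrace_tr hD q).apply_ofFramed hD,
    (isMarkovTrace_tr hD q⁻¹).apply_ofFramed hD, map_evalRingHom_eval, map_evalRingHom_eval,
    univ_mirror hD, inv_inv, neg_sub]

/-- The shift `z ↦ z - (q - q⁻¹) E_D` becomes inversion of `λ_D`. -/
theorem zD_inv (D : Finset (ZMod d)) (q : ℂ) {lam : ℂ} (h0 : lam ≠ 0) (h1 : lam ≠ 1) :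
    zD D q⁻¹ lam⁻¹ = zD D q lam - (q - q⁻¹) * ED D := by
  have h2 : 1 - lam ≠ 0 := sub_ne_zero.mpr h1.symm
  have h3 : lam - 1 ≠ 0 := sub_ne_zero.mpr h1
  have h4 : 1 - lam⁻¹ = (lam - 1) / lam := by field_simp
  rw [zD, zD, h4, inv_inv, div_div_eq_mul_div, eq_sub_iff_add_eq, div_add' _ _ _ h3,
    div_eq_div_iff h3 h2]
  ring

end Trace

end

end YokonumaHecke

open YokonumaHecke in
theorem mainTheorem5 (d : ℕ) [NeZero d] (D : Finset (ZMod d)) (hD : D.Nonempty)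
    (q : ℂ) (hq : q ≠ 0) :
    -- `tr_{d,D}` is well defined, and `E_D = tr_{d,D}(e_i)`
    ((∃! T : ∀ n : ℕ, Y d q n →ₗ[ℂ] Polynomial ℂ, IsMarkovTrace d q (XD D) T) ∧
      ∀ (n : ℕ) (i : Fin (n - 1)), tr D q n (Y.e i) = Polynomial.C (ED D)) ∧
    ∀ (n : ℕ) (α : Braid n),
      -- the identity in the variables `(q, z)`
      brTr D q (Braid.mirror n α) =
        (brTr D q⁻¹ α).comp (Polynomial.X - Polynomial.C ((q - q⁻¹) * ED D)) ∧
      -- the identity in the variables `(q, λ_D)`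
      ∀ lam : ℂ, lam ≠ 0 → lam ≠ 1 →
        brTrLam D q lam (Braid.mirror n α) = brTrLam D q⁻¹ lam⁻¹ α := by
  refine ⟨⟨⟨tr D q, isMarkovTrace_tr hD q, fun T hT => hT.unique hD (isMarkovTrace_tr hD q)⟩,
    fun n i => tr_e hD i⟩, fun n α => ⟨brTr_mirror hD q α, fun lam h0 h1 => ?_⟩⟩
  rw [brTrLam, brTrLam, brTr_mirror hD, Polynomial.eval_comp, zD_inv D q h0 h1]
  simp
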